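/- Let $\mathbb{F}$ be a finite field. A \emph{code} on a finite index set $I$ is a subspace $\mathcal{C}\subseteq\mathbb{F}^I$; its length is $|I|$. For $J\subseteq I$ let $\mathcal{C}_J$ be the set of codewords vanishing outside $J$. A \emph{tree decomposition} $(T,\omega)$ of $I$ is a finite tree $T$ with a map $\omega:I\to V(T)$. For an edge $e$ of $T$, let $J(e)$ and $\overline{J}(e)$ be the preimages under $\omega$ of the vertex sets of the two components of $T-e$. The minimal tree realization of $\mathcal{C}$ extending $(T,\omega)$ has the state spaces $\mathcal{S}_e^*=\mathcal{C}/(\mathcal{C}_{J(e)}\oplus\mathcal{C}_{\overline{J}(e)})$ and the local constraint codes $$C_v^*=\bigl\{\bigl((c_i)_{\omega(i)=v},\,(c+\mathcal{C}_{J(e)}\oplus\mathcal{C}_{\overline{J}(e)})_{e\ni v}\bigr): c\in\mathcal{C}\bigr\},\qquad v\in V(T).$$ Let $\kappa(\mathcal{C};T,\omega)=\max_{v}\dim C_v^*$ be its constraint complexity. The \emph{treewidth} $\kappa(\mathcal{C})$ is the minimum of $\kappa(\mathcal{C};T,\omega)$ over all tree decompositions of $I$, and the minimum conventional-trellis constraint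 complexity $\kappa_{\mathrm{trellis}}(\mathcal{C})$ is its minimum over those in which $T$ is a simple path on $|I|$ vertices and $\omega$ is a bijection. For a graph $\mathcal{G}$ (parallel edges allowed) with an arbitrary orientation of its edges, let $\mathcal{C}[\mathcal{G}]\subseteq\mathbb{F}^{E(\mathcal{G})}$ be the row space of the vertex-edge incidence matrix (entry $1$ at the tail and $-1$ at the head of a non-loop edge, $0$ elsewhere). Let $Y_1=K_{1,3}$ and, for $i\ge2$, let $Y_i$ be obtained from $Y_{i-1}$ by adding, for each leaf $v$, two new vertices adjacent to $v$. Let $\overline{Y_i}$ be obtained from $Y_i$ by doubling every edge and adding a new vertex joined to each vertex of $Y_i$ by two parallel edges. Then: (1) There is a family of codes $\mathcal{C}_i$, $i=1,2,\dots$, over $\mathbb{F}$ such that $\lim_{i\to\infty}\bigl(\kappa_{\mathrm{trellis}}(\mathcal{C}_i)-\kappa(\mathcal{C}_i)\bigr)=\infty$. (2) Consequently (Forney's Conjecture 3) there is no upper bound on $\kappa_{\mathrm{trellis}}(\mathcal{C})-\kappa(\mathcal{C})$ valid for all codes $\mathcal{C}$ over $\mathbb{F}$. (3) For every choice of orientations,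 the codes $\mathcal{C}_i=\mathcal{C}[\overline{Y_i}]$ form such a family: for all $i\ge1$, $\kappa(\mathcal{C}_i)=2$ and $\kappa_{\mathrm{trellis}}(\mathcal{C}_i)\ge\lceil (i+3)/2\rceil$; hence the gap tends to infinity, and it grows logarithmically in the length $n_i=|E(\overline{Y_i})|$, that is, $\kappa_{\mathrm{trellis}}(\mathcal{C}_i)-\kappa(\mathcal{C}_i)=\Theta(\log n_i)$ as $i\to\infty$. -/

import Mathlib

open Filter Topology Asymptotics
open scoped Graph

noncomputable section

/-! ### Codes and tree decompositions of their index sets -/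

/-- A tree decomposition `(T, ω)` of the index set `I`: a finite tree `T` and an arbitrary map `ω`
from `I` to the vertex set of `T`. -/
structure TreeDecomposition (I : Type*) where
  /-- the vertex set of the tree -/
  V : Type
  finite_V : Finite V
  /-- the tree -/
  T : SimpleGraph V
  isTree : T.IsTree
  /-- the assignment of indices to vertices -/
  ω : I → V

/-- A path decomposition of `I`: the tree is a simple path on `|I|` vertices, and `ω` is a
bijection. -/
def TreeDecomposition.IsPathDecomposition {I : Type*} (D : TreeDecomposition I) : Prop :=
  Nonempty (D.T ≃g SimpleGraph.pathGraph (Nat.card I)) ∧ Function.Bijective D.ω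

section Codes

variable {F : Type*} [Field F] {I : Type*}

/-- The cross-section `C_J` of the code `C`, extended by zero outside of `J`: the codewords of `C`
that vanish off `J`. -/
def crossSection (C : Submodule F (I → F)) (J : Set I) : Submodule F (I → F) where
  carrier := {c | c ∈ C ∧ ∀ i, i ∉ J → c i = 0}
  add_mem' := by
    rintro a b ⟨ha, ha'⟩ ⟨hb, hb'⟩
    exact ⟨C.add_mem ha hb, fun i hi => by simp [ha' i hi, hb' i hi]⟩
  zero_mem' := ⟨C.zero_mem, fun _ _ => rfl⟩
  smul_mem' := by
    rintro r a ⟨ha, ha'⟩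
    exact ⟨C.smul_mem r ha, fun i hi => by simp [ha' i hi]⟩

/-- The subspace `C_{J(e)} ⊕ C_{J̄(e)}` of `C`. The sum runs over the connected components of
`T - e`; if `e` is an edge of the tree `T`, these are the two subtrees `T_e` and `T̄_e`, and their
preimages under `ω` are `J(e)` and `J̄(e)`. -/
def splitSubcode (C : Submodule F (I → F)) (D : TreeDecomposition I) (e : Sym2 D.V) :
    Submodule F C :=
  (⨆ K : (D.T.deleteEdges {e}).ConnectedComponent, crossSection C (D.ω ⁻¹' K.supp)).submoduleOf C

/-- The state space `C / (C_{J(e)} ⊕ C_{J̄(e)})` of the minimal tree realization at the edge `e`. -/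
abbrev StateSpace (C : Submodule F (I → F)) (D : TreeDecomposition I) (e : Sym2 D.V) : Type _ :=
  C ⧸ splitSubcode C D e

/-- The map sending a codeword `c` to its local configuration at `v` in the minimal tree
realization: the symbols `c i` with `ω i = v`, and the states, i.e. the cosets
`c + (C_{J(e)} ⊕ C_{J̄(e)})`, at the edges `e` of `T` that are incident with `v`. -/
def localConfiguration (C : Submodule F (I → F)) (D : TreeDecomposition I) (v : D.V) :
    C →ₗ[F] (D.ω ⁻¹' {v} → F) × (∀ e : D.T.incidenceSet v, StateSpace C D e.1) :=
  LinearMap.prod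
    (LinearMap.funLeft F F (Subtype.val : D.ω ⁻¹' {v} → I) ∘ₗ C.subtype)
    (LinearMap.pi fun e => (splitSubcode C D e.1).mkQ)

/-- The local constraint code at `v` of the minimal tree realization of `C` extending `(T, ω)`. -/
def localConstraint (C : Submodule F (I → F)) (D : TreeDecomposition I) (v : D.V) :
    Submodule F ((D.ω ⁻¹' {v} → F) × (∀ e : D.T.incidenceSet v, StateSpace C D e.1)) :=
  LinearMap.range (localConfiguration C D v)

/-- `κ(C; T, ω)`: the constraint complexity of the minimal tree realization of `C` that extends
`(T, ω)`, i.e. the largest dimension of a local constraint code. -/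
def constraintComplexity (C : Submodule F (I → F)) (D : TreeDecomposition I) : ℕ :=
  ⨆ v : D.V, Module.finrank F (localConstraint C D v)

/-- The treewidth `κ(C)` of a code: the minimum of `κ(C; T, ω)` over all tree decompositions. -/
def codeTreewidth (C : Submodule F (I → F)) : ℕ :=
  sInf {k | ∃ D : TreeDecomposition I, constraintComplexity C D = k}

/-- The minimum constraint complexity `κ_trellis(C)` of a conventional trellis realization of a
code: the minimum of `κ(C; T, ω)` over all path decompositions. -/
def trellisComplexity (C : Submodule F (I → F)) : ℕ :=
  sInf {k | ∃ D : TreeDecomposition I, D.IsPathDecomposition ∧ constraintComplexity C D = k}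

end Codes

/-! ### The code of a graph -/

/-- An orientation of the edges of a (multi)graph. -/
structure EdgeOrientation {α β : Type*} (G : Graph α β) where
  /-- the tail of an edge -/
  tail : E(G) → α
  /-- the head of an edge -/
  head : E(G) → α
  isLink : ∀ e : E(G), G.IsLink e (tail e) (head e)

open Classical in
/-- The vertex-edge incidence matrix, over `F`, of an oriented graph. -/
def incidenceMatrix (F : Type*) [Field F] {α β : Type*} {G : Graph α β} (D : EdgeOrientation G) :
    Matrix V(G) E(G) F :=
  fun v e =>
    if D.tail e = D.head e then 0
    else if v.1 = D.tail e then 1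
    else if v.1 = D.head e then -1
    else 0

/-- The code `C[G]` over `F`: the row space of the incidence matrix. -/
def graphCode (F : Type*) [Field F] {α β : Type*} {G : Graph α β} (D : EdgeOrientation G) :
    Submodule F (E(G) → F) :=
  Submodule.span F (Set.range (incidenceMatrix F D))

/-! ### The graphs `Y_i` and `Ȳ_i` -/

/-- The graph `G` together with an extra vertex, `none`, adjacent to all vertices of `G`. -/
def cone {V : Type*} (G : SimpleGraph V) : SimpleGraph (Option V) where
  Adj
    | none, none => False
    | none, some _ => True
    | some _, none => True
    | some u, some v => G.Adj u v
  symm := ⟨by rintro (_ | u) (_ | v) h <;> first | exact h | exact G.symm.symm _ _ h⟩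
  loopless := ⟨by rintro (_ | u) h; exacts [h, G.loopless.irrefl _ h]⟩

/-- The multigraph obtained from a simple graph by replacing each edge `e` by the two parallel edges
`(e, false)` and `(e, true)`. -/
def doubleEdges {V : Type*} (G : SimpleGraph V) : Graph V (Sym2 V × Bool) where
  vertexSet := Set.univ
  IsLink e u v := G.Adj u v ∧ e.1 = s(u, v)
  isLink_symm e _ := ⟨fun u v h => ⟨h.1.symm, h.2.trans Sym2.eq_swap⟩⟩
  eq_or_eq_of_isLink_of_isLink := by
    rintro e x y v w ⟨-, h⟩ ⟨-, h'⟩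
    rw [h, Sym2.eq_iff] at h'
    exact h'.imp And.left And.left
  left_mem_of_isLink := fun _ _ _ _ => Set.mem_univ _

/-- The multigraph `Ḡ`: double all edges of the simple graph `G`, and add an extra vertex that is
joined to every vertex of `G` by a pair of parallel edges. -/
def barGraph {V : Type*} (G : SimpleGraph V) : Graph (Option V) (Sym2 (Option V) × Bool) :=
  doubleEdges (cone G)

/-- The leaves of a graph: its vertices of degree one. -/
def leaves {V : Type*} (G : SimpleGraph V) : Set V := {v | (G.neighborSet v).ncard = 1}

/-- The graph obtained from `G` by adding, for each leaf `v`, two new vertices adjacent to `v`. -/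
def branchLeaves {V : Type*} (G : SimpleGraph V) : SimpleGraph (V ⊕ leaves G × Bool) where
  Adj
    | .inl u, .inl v => G.Adj u v
    | .inl u, .inr (v, _) => u = v
    | .inr (u, _), .inl v => v = u
    | .inr _, .inr _ => False
  symm := ⟨by rintro (u | u) (v | v) h <;> first | exact h | exact G.symm.symm _ _ h⟩
  loopless := ⟨by rintro (u | u) h; exacts [G.loopless.irrefl _ h, h]⟩

/-- The trees `Y_i`, `i ≥ 1`, with their vertex sets: `Y_1` is the complete bipartite graph
`K_{1,3}`, and `Y_i` is obtained from `Y_{i-1}` by adding two new vertices adjacent to each leaf.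
The value at `0` is irrelevant (it is set to `K_{1,3}` as well). -/
def treeY : ℕ → Σ V : Type, SimpleGraph V
  | 0 => ⟨Fin 1 ⊕ Fin 3, completeBipartiteGraph (Fin 1) (Fin 3)⟩
  | 1 => ⟨Fin 1 ⊕ Fin 3, completeBipartiteGraph (Fin 1) (Fin 3)⟩
  | i + 2 => ⟨_, branchLeaves (treeY (i + 1)).2⟩

/-- The multigraph `Ȳ_i`. -/
def barY (i : ℕ) : Graph (Option (treeY i).1) (Sym2 (Option (treeY i).1) × Bool) :=
  barGraph (treeY i).2

end

/-! ### Codewords from potentials -/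

/-! Codewords of `C[Ḡ]` are differences of vertex potentials, normalised to vanish at the extra
vertex, so everything is linear algebra on `V → F`. For an edge set `A`, the potentials whose
codeword splits into a codeword on `A` plus one off `A` form `separated`. Its codimension is the
connectivity of `A` in the cycle matroid. The dimension of a local constraint code is the
codimension of `potentialKer`. A zero state at a tree edge means that the codeword splits there, so
this dimension bounds the connectivity of every adjacent cut (`potentialKer_le_separated`).

Trellis lower bound: a path decomposition orders the edges of `Ḡ`, and some initial segment must
have large connectivity. As for the pathwidth of trees, take three disjoint branches, each having a
cut of connectivity `m`. At the median of the three cut times, the middle branch contributes `m`.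
The rest, which is connected, has edges on both sides and contributes one more
(`WidthGE.three_branches`). In a binary tree this gains one every two levels, and the centre of
`Y_i` gains one more.

Treewidth: for a tree `G`, decomposing along `G` itself with bags `{v, par v}` gives complexity at
most 2. Complexity at most 1 would make all kernels at vertices carrying an edge coincide, hence
vanish (`two_le_constraintComplexity`).

Growth: an interval representation of `Y_i` with overlap linear in `i` bounds the trellis complexity
from above. The length is exponential in `i`, so the gap is of the order of its logarithm. -/

section Potentials

variable {F : Type*} [Field F] {V : Type*} {G : SimpleGraph V}

/-- The extension of a potential on the vertices of `G` by zero at the extra vertex of the cone. -/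
def extendZero (F V : Type*) [Field F] : (V → F) →ₗ[F] (Option V → F) where
  toFun p x := x.elim 0 p
  map_add' p q := by ext (_ | x) <;> simp
  map_smul' r p := by ext (_ | x) <;> simp

@[simp] theorem extendZero_none (p : V → F) : extendZero F V p none = 0 := rfl

@[simp] theorem extendZero_some (p : V → F) (v : V) : extendZero F V p (some v) = p v := rfl

/-- The map sending a potential to its differences along the edges of an oriented graph. -/
def potentialDiff (F : Type*) [Field F] {α β : Type*} {H : Graph α β} (D : EdgeOrientation H) :
    (α → F) →ₗ[F] (E(H) → F) where
  toFun P e := P (D.tail e) - P (D.head e)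
  map_add' P Q := by ext e; simp only [Pi.add_apply]; ring
  map_smul' r P := by ext e; simp only [Pi.smul_apply, smul_eq_mul, RingHom.id_apply]; ring

theorem incidenceMatrix_eq_potentialDiff {α β : Type*} [DecidableEq α] {H : Graph α β}
    (D : EdgeOrientation H) (v : V(H)) :
    incidenceMatrix F D v = potentialDiff F D (Pi.single v.1 1) := by
  ext e
  simp only [incidenceMatrix, potentialDiff, LinearMap.coe_mk, AddHom.coe_mk, Pi.single_apply,
    eq_comm (a := v.1)]
  split_ifs <;> simp_all

theorem range_potentialDiff {α β : Type*} [Finite α] {H : Graph α β} (D : EdgeOrientation H)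
    (hH : V(H) = Set.univ) : LinearMap.range (potentialDiff F D) = graphCode F D := by
  classical
  have := Fintype.ofFinite α
  rw [LinearMap.range_eq_map, ← (Pi.basisFun F α).span_eq, Submodule.map_span, graphCode]
  congr 1
  ext c
  constructor
  · rintro ⟨_, ⟨v, rfl⟩, rfl⟩
    exact ⟨⟨v, hH ▸ Set.mem_univ v⟩, by rw [incidenceMatrix_eq_potentialDiff, Pi.basisFun_apply]⟩
  · rintro ⟨v, rfl⟩
    exact ⟨_, ⟨v.1, rfl⟩, by rw [incidenceMatrix_eq_potentialDiff, Pi.basisFun_apply]⟩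

/-- The codeword of `C[Ḡ]` given by a potential that vanishes at the extra vertex. -/
def potentialCode (F : Type*) [Field F] [Finite V] (D : EdgeOrientation (barGraph G)) :
    (V → F) →ₗ[F] graphCode F D :=
  (potentialDiff F D ∘ₗ extendZero F V).codRestrict _ fun p => by
    rw [← range_potentialDiff D rfl]
    exact ⟨_, rfl⟩

theorem potentialCode_apply [Finite V] (D : EdgeOrientation (barGraph G)) (p : V → F)
    (e : E(barGraph G)) : (potentialCode F D p).1 e =
      extendZero F V p (D.tail e) - extendZero F V p (D.head e) := rfl

theorem potentialCode_surjective [Finite V] (D : EdgeOrientation (barGraph G)) :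
    Function.Surjective (potentialCode F D) := by
  rintro ⟨c, hc⟩
  rw [← range_potentialDiff D rfl] at hc
  obtain ⟨P, rfl⟩ := hc
  -- Shifting a potential by a constant does not change its differences.
  refine ⟨fun v => P (some v) - P none, Subtype.ext (funext fun e => ?_)⟩
  have h : ∀ x, extendZero F V (fun v => P (some v) - P none) x = P x - P none := by
    rintro (_ | x) <;> simp
  rw [potentialCode_apply, h, h]
  change _ = P _ - P _
  ring

theorem barGraph_isLink {x y : Option V} (h : (cone G).Adj x y) (b : Bool) :
    (barGraph G).IsLink (s(x, y), b) x y := ⟨h, rfl⟩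

theorem mem_edgeSet_barGraph {x y : Option V} (h : (cone G).Adj x y) (b : Bool) :
    (s(x, y), b) ∈ E(barGraph G) := (barGraph_isLink h b).edge_mem

theorem cone_adj_none (v : V) : (cone G).Adj none (some v) := trivial

theorem EdgeOrientation.tail_head_eq_or (D : EdgeOrientation (barGraph G)) {x y : Option V}
    {e : E(barGraph G)} (he : e.1.1 = s(x, y)) :
    D.tail e = x ∧ D.head e = y ∨ D.tail e = y ∧ D.head e = x :=
  Sym2.eq_iff.1 ((D.isLink e).2.symm.trans he)

theorem potentialCode_eq_iff [Finite V] (D : EdgeOrientation (barGraph G)) (p q : V → F)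
    {x y : Option V} {e : E(barGraph G)} (he : e.1.1 = s(x, y)) :
    (potentialCode F D q).1 e = (potentialCode F D p).1 e ↔
      extendZero F V q x - extendZero F V q y = extendZero F V p x - extendZero F V p y := by
  rw [potentialCode_apply, potentialCode_apply]
  rcases D.tail_head_eq_or he with ⟨h, h'⟩ | ⟨h, h'⟩
  · rw [h, h']
  · rw [h, h']
    constructor <;> intro h <;> linear_combination -h

/-! ### Separated potentials -/

/-- The potentials `p` on `G` such that, in the cone over the vertex set `S` with doubled edges, the
codeword of `p` remains a codeword when it is set to zero off the edge set `A`. -/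
def separated (F : Type*) [Field F] (G : SimpleGraph V) (S : Set V)
    (A : Set (Sym2 (Option V) × Bool)) : Submodule F (V → F) where
  carrier := {p | ∃ q : V → F,
    (∀ v ∈ S, ∀ b, ((s(none, some v), b) ∈ A → q v = p v) ∧
      ((s(none, some v), b) ∉ A → q v = 0)) ∧
    ∀ u ∈ S, ∀ v ∈ S, G.Adj u v → ∀ b, ((s(some u, some v), b) ∈ A → q u - q v = p u - p v) ∧
      ((s(some u, some v), b) ∉ A → q u = q v)}
  add_mem' := by
    rintro p p' ⟨q, h, h'⟩ ⟨r, k, k'⟩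
    refine ⟨q + r, fun v hv b => ⟨fun ha => ?_, fun ha => ?_⟩,
      fun u hu v hv a b => ⟨fun ha => ?_, fun ha => ?_⟩⟩
    · simp [(h v hv b).1 ha, (k v hv b).1 ha]
    · simp [(h v hv b).2 ha, (k v hv b).2 ha]
    · have h1 := (h' u hu v hv a b).1 ha
      have h2 := (k' u hu v hv a b).1 ha
      simp only [Pi.add_apply]
      linear_combination h1 + h2
    · simp [(h' u hu v hv a b).2 ha, (k' u hu v hv a b).2 ha]
  zero_mem' := ⟨0, by simp⟩
  smul_mem' := by
    rintro c p ⟨q, h, h'⟩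
    refine ⟨c • q, fun v hv b => ⟨fun ha => ?_, fun ha => ?_⟩,
      fun u hu v hv a b => ⟨fun ha => ?_, fun ha => ?_⟩⟩
    · simp [(h v hv b).1 ha]
    · simp [(h v hv b).2 ha]
    · have h1 := (h' u hu v hv a b).1 ha
      simp only [Pi.smul_apply, smul_eq_mul]
      linear_combination c * h1
    · simp [(h' u hu v hv a b).2 ha]

theorem separated_anti {S T : Set V} (h : S ⊆ T) (A : Set (Sym2 (Option V) × Bool)) :
    separated F G T A ≤ separated F G S A := by
  rintro p ⟨q, h1, h2⟩
  exact ⟨q, fun v hv => h1 v (h hv), fun u hu v hv => h2 u (h hu) v (h hv)⟩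

theorem mem_separated_of_eq_zero {S : Set V} {p : V → F} (hp : ∀ v ∈ S, p v = 0)
    (A : Set (Sym2 (Option V) × Bool)) : p ∈ separated F G S A :=
  ⟨0, fun v hv b => by simp [hp v hv], fun u hu v hv _ b => by simp [hp u hu, hp v hv]⟩

/-- A potential vanishing on a set is separated there. Every potential is the sum of one vanishing
on `S` and one supported on `S`, which vanishes on `T`. -/
theorem separated_sup_eq_top {S T : Set V} (h : Disjoint S T)
    (A : Set (Sym2 (Option V) × Bool)) : separated F G S A ⊔ separated F G T A = ⊤ := by
  classical
  rw [eq_top_iff]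
  intro p _
  rw [show p = (fun v => if v ∈ S then 0 else p v) + fun v => if v ∈ S then p v else 0 by
    ext v; by_cases hv : v ∈ S <;> simp [hv]]
  refine Submodule.add_mem_sup (mem_separated_of_eq_zero (fun v hv => by simp [hv]) A)
    (mem_separated_of_eq_zero (fun v hv => ?_) A)
  simpa using fun hS => (h.notMem_of_mem_left hS hv).elim

/-- The connectivity of `A` in the cycle matroid of the cone over `S` with doubled edges is at least
`m`. -/
def ConnectivityGE (F : Type*) [Field F] (G : SimpleGraph V) (S : Set V)
    (A : Set (Sym2 (Option V) × Bool)) (m : ℕ) : Prop :=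
  Module.finrank F (separated F G S A) + m ≤ Nat.card V

theorem ConnectivityGE.mono [Finite V] {S T : Set V} (h : S ⊆ T)
    {A : Set (Sym2 (Option V) × Bool)} {m : ℕ} (hS : ConnectivityGE F G S A m) :
    ConnectivityGE F G T A m :=
  (Nat.add_le_add_right (Submodule.finrank_mono (separated_anti h A)) m).trans hS

theorem finrank_potentials [Finite V] : Module.finrank F (V → F) = Nat.card V := by
  have := Fintype.ofFinite V
  rw [Module.finrank_pi, Nat.card_eq_fintype_card]

/-- The two separated spaces span everything, so the codimension of their intersection is the sum of
the codimensions. The separated space of `U` lies in that intersection. -/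
theorem ConnectivityGE.add [Finite V] {S T U : Set V} (hST : Disjoint S T) (hS : S ⊆ U)
    (hT : T ⊆ U) {A : Set (Sym2 (Option V) × Bool)} {m n : ℕ} (h1 : ConnectivityGE F G S A m)
    (h2 : ConnectivityGE F G T A n) : ConnectivityGE F G U A (m + n) := by
  have h := Submodule.finrank_sup_add_finrank_inf_eq (separated F G S A) (separated F G T A)
  rw [separated_sup_eq_top hST, finrank_top, finrank_potentials] at h
  have h' := Submodule.finrank_mono (le_inf (separated_anti (F := F) (G := G) hS A)
    (separated_anti hT A))
  unfold ConnectivityGE at *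
  omega

theorem ConnectivityGE.ne_top [Finite V] {S : Set V} {A : Set (Sym2 (Option V) × Bool)} {m : ℕ}
    (h : ConnectivityGE F G S A m) (hm : 0 < m) : separated F G S A ≠ ⊤ := by
  intro h'
  rw [ConnectivityGE, h', finrank_top, finrank_potentials] at h
  omega

theorem connectivityGE_one [Finite V] {S : Set V} {A : Set (Sym2 (Option V) × Bool)}
    (h : separated F G S A ≠ ⊤) : ConnectivityGE F G S A 1 := by
  have := Submodule.finrank_lt h
  rw [finrank_potentials] at this
  exact this

theorem connectivityGE_of_forall_eq_zero [Finite V] {S T : Set V}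
    {A : Set (Sym2 (Option V) × Bool)} (h : ∀ p ∈ separated F G S A, ∀ v ∈ T, p v = 0) : ConnectivityGE F G S A T.ncard := by
  classical
  have := Fintype.ofFinite V
  let f : separated F G S A →ₗ[F] ((Tᶜ : Set V) → F) :=
    LinearMap.funLeft F F (Subtype.val : (Tᶜ : Set V) → V) ∘ₗ (separated F G S A).subtype
  have hf : Function.Injective f := by
    rw [← LinearMap.ker_eq_bot, LinearMap.ker_eq_bot']
    rintro ⟨p, hp⟩ h0
    refine Subtype.ext (funext fun v => ?_)
    by_cases hv : v ∈ T
    · exact h p hp v hv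
    · exact congrFun h0 ⟨v, hv⟩
  have h1 := LinearMap.finrank_le_finrank_of_injective hf
  rw [finrank_potentials, Nat.card_coe_set_eq] at h1
  have h2 := Set.ncard_add_ncard_compl T
  unfold ConnectivityGE
  omega

/-- The vertex set `S` is connected in `G`. -/
def ConnectedOn (G : SimpleGraph V) (S : Set V) : Prop :=
  ∀ X : Set V, (∀ u ∈ S, ∀ v ∈ S, G.Adj u v → u ∈ X → v ∈ X) → ∀ u ∈ S, ∀ v ∈ S, u ∈ X → v ∈ X

/-- The edges of the cone over `S` with doubled edges. -/
def coneEdges (G : SimpleGraph V) (S : Set V) : Set (Sym2 (Option V) × Bool) :=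
  {e | (∃ v ∈ S, e.1 = s(none, some v)) ∨ ∃ u ∈ S, ∃ v ∈ S, G.Adj u v ∧ e.1 = s(some u, some v)}

theorem coneEdges_mono {S T : Set V} (h : S ⊆ T) : coneEdges G S ⊆ coneEdges G T := by
  rintro e (⟨v, hv, he⟩ | ⟨u, hu, v, hv, ha, he⟩)
  exacts [.inl ⟨v, h hv, he⟩, .inr ⟨u, h hu, v, h hv, ha, he⟩]

theorem exists_mem_of_separated_ne_top {S : Set V} {A : Set (Sym2 (Option V) × Bool)}
    (h : separated F G S A ≠ ⊤) : ∃ e ∈ coneEdges G S, e ∈ A := by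
  by_contra! hA
  refine h (eq_top_iff.2 fun p _ => ⟨0, fun v hv b => ⟨fun ha => ?_, fun _ => rfl⟩,
    fun u hu v hv a b => ⟨fun ha => ?_, fun _ => rfl⟩⟩)
  · exact (hA _ (.inl ⟨v, hv, rfl⟩) ha).elim
  · exact (hA _ (.inr ⟨u, hu, v, hv, a, rfl⟩) ha).elim

theorem exists_notMem_of_separated_ne_top {S : Set V} {A : Set (Sym2 (Option V) × Bool)}
    (h : separated F G S A ≠ ⊤) : ∃ e ∈ coneEdges G S, e ∉ A := by
  by_contra! hA
  refine h (eq_top_iff.2 fun p _ => ⟨p, fun v hv b => ⟨fun _ => rfl, fun ha => ?_⟩,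
    fun u hu v hv a b => ⟨fun _ => rfl, fun ha => ?_⟩⟩)
  · exact (ha (hA _ (.inl ⟨v, hv, rfl⟩))).elim
  · exact (ha (hA _ (.inr ⟨u, hu, v, hv, a, rfl⟩))).elim

/-- The cone over a connected set has a connected cycle matroid. If every potential were separated,
splitting the constant 1 would put all edges at the extra vertex on one side, and splitting an
indicator of `u` would put each edge at `u` on that same side. -/
theorem separated_ne_top {S : Set V} (hS : ConnectedOn G S) {A : Set (Sym2 (Option V) × Bool)}
    (h1 : ∃ e ∈ coneEdges G S, e ∈ A) (h2 : ∃ e ∈ coneEdges G S, e ∉ A) :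
    separated F G S A ≠ ⊤ := by
  classical
  intro htop
  have hmem : ∀ p : V → F, p ∈ separated F G S A := fun p => htop ▸ Submodule.mem_top
  obtain ⟨q, hq, hq'⟩ := hmem 1
  have hapex : ∀ v ∈ S, ∀ b, (s(none, some v), b) ∈ A ↔ q v = 1 := by
    intro v hv b
    refine ⟨(hq v hv b).1, fun h => ?_⟩
    by_contra ha
    exact one_ne_zero (h.symm.trans ((hq v hv b).2 ha))
  have hconst : ∀ u ∈ S, ∀ v ∈ S, q u = 1 → q v = 1 := by
    refine hS {v | q v = 1} fun u hu v hv a (hu1 : q u = 1) => ?_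
    have : q u = q v := by
      by_cases ha : (s(some u, some v), true) ∈ A
      · simpa [sub_eq_zero] using (hq' u hu v hv a true).1 ha
      · exact (hq' u hu v hv a true).2 ha
    exact this.symm.trans hu1
  have hedge : ∀ u ∈ S, ∀ v ∈ S, G.Adj u v → ∀ b, (s(some u, some v), b) ∈ A ↔ q u = 1 := by
    intro u hu v hv a b
    obtain ⟨r, hr, hr'⟩ := hmem (Pi.single u 1)
    have hvu : v ≠ u := a.ne'
    constructor
    · intro ha
      by_contra h
      have hu0 := (hr u hu true).2 (fun k => h ((hapex u hu true).1 k))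
      have hv0 := (hr v hv true).2 (fun k => h (hconst v hv u hu ((hapex v hv true).1 k)))
      simpa [hu0, hv0, hvu] using (hr' u hu v hv a b).1 ha
    · intro h
      by_contra ha
      have hu0 := (hr u hu true).1 ((hapex u hu true).2 h)
      have hv0 := (hr v hv true).1 ((hapex v hv true).2 (hconst u hu v hv h))
      simpa [hu0, hv0, hvu] using (hr' u hu v hv a b).2 ha
  have key : ∀ e ∈ coneEdges G S, ∃ v ∈ S, (e ∈ A ↔ q v = 1) := by
    rintro ⟨e, b⟩ (⟨v, hv, rfl⟩ | ⟨u, hu, v, hv, a, rfl⟩)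
    exacts [⟨v, hv, hapex v hv b⟩, ⟨u, hu, hedge u hu v hv a b⟩]
  obtain ⟨e, he, hA⟩ := h1
  obtain ⟨e', he', hA'⟩ := h2
  obtain ⟨v, hv, hev⟩ := key e he
  obtain ⟨w, hw, hew⟩ := key e' he'
  exact hA' (hew.2 (hconst v hv w hw (hev.1 hA)))

end Potentials

/-! ### Lower bounds for the width of an edge ordering -/

section Width

variable {F : Type*} [Field F] {V : Type*} {G : SimpleGraph V}

theorem ConnectedOn.singleton (v : V) : ConnectedOn G {v} := by
  rintro X - u rfl w rfl h
  exact h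

theorem ConnectedOn.union {S T : Set V} (hS : ConnectedOn G S) (hT : ConnectedOn G T) {a b : V}
    (ha : a ∈ S) (hb : b ∈ T) (hab : G.Adj a b) : ConnectedOn G (S ∪ T) := by
  intro X hX
  have h1 := hS X fun u hu v hv => hX u (.inl hu) v (.inl hv)
  have h2 := hT X fun u hu v hv => hX u (.inr hu) v (.inr hv)
  have h3 := hX a (.inl ha) b (.inr hb) hab
  have h4 := hX b (.inr hb) a (.inl ha) hab.symm
  rintro u (hu | hu) v (hv | hv) hx
  exacts [h1 u hu v hv hx, h2 b hb v hv (h3 (h1 u hu a ha hx)),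
    h1 a ha v hv (h4 (h2 u hu b hb hx)), h2 u hu v hv hx]

theorem ConnectedOn.insert_root {S : Set V} (hS : ConnectedOn G S) {r u : V} (hu : u ∈ S)
    (h : G.Adj r u) : ConnectedOn G (insert r S) :=
  (ConnectedOn.singleton r).union hS rfl hu h

/-- In the ordering of edges given by `τ`, some initial segment has connectivity at least `m` in the
cone over `S`. -/
def WidthGE (F : Type*) [Field F] (G : SimpleGraph V) (τ : Sym2 (Option V) × Bool → ℕ) (S : Set V)
    (m : ℕ) : Prop :=
  ∃ k, ConnectivityGE F G S {e | τ e ≤ k} m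

variable [Finite V] {τ : Sym2 (Option V) × Bool → ℕ}

theorem WidthGE.mono {S T : Set V} (h : S ⊆ T) {m : ℕ} (hS : WidthGE F G τ S m) :
    WidthGE F G τ T m :=
  hS.imp fun _ => ConnectivityGE.mono h

/-- Cutting at the earlier of the two parallel edges from `v` to the extra vertex leaves one on each
side, which forces `p v = q v = 0`. -/
theorem widthGE_singleton (hτ : Set.InjOn τ (coneEdges G Set.univ)) (v : V) :
    WidthGE F G τ {v} 1 := by
  have hmem : ∀ b, (s(none, some v), b) ∈ coneEdges G Set.univ := fun b => .inl ⟨v, trivial, rfl⟩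
  obtain ⟨b, hb⟩ : ∃ b, τ (s(none, some v), b) < τ (s(none, some v), !b) := by
    rcases lt_or_gt_of_ne (hτ.ne (hmem true) (hmem false) (by simp)) with h | h
    exacts [⟨true, h⟩, ⟨false, h⟩]
  refine ⟨τ (s(none, some v), b), ?_⟩
  have := connectivityGE_of_forall_eq_zero (F := F) (G := G) (S := {v}) (T := {v})
    (A := {e | τ e ≤ τ (s(none, some v), b)}) ?_
  · simpa using this
  rintro p ⟨q, hq, -⟩ _ rfl
  rw [← (hq _ rfl b).1 (le_refl (τ _)), (hq _ rfl (!b)).2 hb.not_ge]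

theorem exists_ne_fst_of_two_lt_card {α : Type*} [DecidableEq α] {s : Finset (α × Bool)}
    (hs : 2 < s.card) : ∃ x ∈ s, ∃ y ∈ s, x.1 ≠ y.1 := by
  by_contra! h
  obtain ⟨z, hz⟩ := Finset.card_pos.1 (by omega : 0 < s.card)
  have : s ⊆ {(z.1, true), (z.1, false)} := by
    rintro ⟨a, b⟩ hx
    have := h _ hx _ hz
    cases b <;> simp_all
  exact absurd ((Finset.card_le_card this).trans Finset.card_le_two) (by omega)

/-- Discrete continuity: by injectivity the count grows by at most one as `k` increases by one. -/
theorem exists_card_filter_le_eq {ι : Type*} [Fintype ι] {f : ι → ℕ} (hf : Function.Injective f)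
    {m : ℕ} (hm : 0 < m) (hmι : m ≤ Fintype.card ι) :
    ∃ k, (Finset.univ.filter fun x => f x ≤ k).card = m := by
  classical
  have hex : ∃ k, m ≤ (Finset.univ.filter fun x => f x ≤ k).card := by
    refine ⟨Finset.univ.sup f, ?_⟩
    rwa [Finset.filter_true_of_mem fun x hx => Finset.le_sup hx, Finset.card_univ]
  refine ⟨Nat.find hex, le_antisymm ?_ (Nat.find_spec hex)⟩
  have hone : ∀ k, (Finset.univ.filter fun x => f x = k).card ≤ 1 := fun k =>
    Finset.card_le_one.2 fun a ha b hb => hf (by simp_all)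
  rcases h : Nat.find hex with _ | k
  · simp only [Nat.le_zero]
    exact (hone 0).trans hm
  · have hlt := Nat.find_min hex (m := k) (by omega)
    have : (Finset.univ.filter fun x => f x ≤ k + 1) ⊆
        (Finset.univ.filter fun x => f x ≤ k) ∪ Finset.univ.filter fun x => f x = k + 1 := by
      intro x
      simp only [Finset.mem_filter, Finset.mem_univ, true_and, Finset.mem_union]
      omega
    have h1 := (Finset.card_le_card this).trans (Finset.card_union_le _ _)
    have h2 := hone (k + 1)
    omega

theorem two_of_three {R : Fin 3 → Prop} {i j : Fin 3} (hij : i ≠ j) (hi : R i) (hj : R j) :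
    R 0 ∧ R 1 ∨ R 0 ∧ R 2 ∨ R 1 ∧ R 2 := by
  have h : ∀ k : Fin 3, k = 0 ∨ k = 1 ∨ k = 2 := by decide
  rcases h i with rfl | rfl | rfl <;> rcases h j with rfl | rfl | rfl <;> tauto

/-- Cut the six edges of the doubled triangle on `u`, `v` and the extra vertex after the third.
Three edges meet at least two parallel classes, so each side spans the triangle, and the
connectivity is 2 + 2 - 2. -/
theorem widthGE_pair (hτ : Set.InjOn τ (coneEdges G Set.univ)) {u v : V} (h : G.Adj u v) :
    WidthGE F G τ {u, v} 2 := by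
  classical
  let g : Fin 3 → Sym2 (Option V) := ![s(none, some u), s(none, some v), s(some u, some v)]
  have hg : Function.Injective g := by
    have := h.ne
    intro i j
    fin_cases i <;> fin_cases j <;> simp [g, this, this.symm]
  have hgE : ∀ i b, (g i, b) ∈ coneEdges G Set.univ := by
    intro i b
    fin_cases i
    exacts [.inl ⟨u, trivial, rfl⟩, .inl ⟨v, trivial, rfl⟩, .inr ⟨u, trivial, v, trivial, h, rfl⟩]
  have hinj : Function.Injective fun x : Fin 3 × Bool => τ (g x.1, x.2) := by
    rintro ⟨i, b⟩ ⟨j, c⟩ hx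
    have := hτ (hgE i b) (hgE j c) hx
    simp only [Prod.mk.injEq] at this
    rw [hg this.1, this.2]
  obtain ⟨k, hk⟩ := exists_card_filter_le_eq hinj (m := 3) (by norm_num) (by simp)
  have hk' := Finset.card_compl (Finset.univ.filter fun x : Fin 3 × Bool => τ (g x.1, x.2) ≤ k)
  rw [hk] at hk'
  obtain ⟨x, hx, y, hy, hxy⟩ := exists_ne_fst_of_two_lt_card (by rw [hk]; norm_num)
  obtain ⟨z, hz, w, hw, hzw⟩ := exists_ne_fst_of_two_lt_card (by rw [hk']; simp)
  simp only [Finset.mem_filter, Finset.mem_univ, true_and, Finset.compl_filter] at hx hy hz hw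
  have hcard : ({u, v} : Set V).ncard = 2 := Set.ncard_pair h.ne
  refine ⟨k, hcard ▸ connectivityGE_of_forall_eq_zero ?_⟩
  rintro p ⟨q, hq, hq'⟩
  have hu := hq u (.inl rfl)
  have hv := hq v (.inr rfl)
  have huv := hq' u (.inl rfl) v (.inr rfl) h
  have h1 : q u = p u ∧ q v = p v := by
    have key : ∀ i b, τ (g i, b) ≤ k →
        (![q u = p u, q v = p v, q u - q v = p u - p v] : Fin 3 → Prop) i := by
      intro i b hi
      fin_cases i
      exacts [(hu b).1 hi, (hv b).1 hi, (huv b).1 hi]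
    rcases two_of_three hxy (key _ _ hx) (key _ _ hy) with ⟨h, h'⟩ | ⟨h, h'⟩ | ⟨h, h'⟩
    · exact ⟨h, h'⟩
    · change q u = p u at h
      change q u - q v = p u - p v at h'
      exact ⟨h, by linear_combination h - h'⟩
    · change q v = p v at h
      change q u - q v = p u - p v at h'
      exact ⟨by linear_combination h + h', h⟩
  have h2 : q u = 0 ∧ q v = 0 := by
    have key : ∀ i b, ¬ τ (g i, b) ≤ k →
        (![q u = 0, q v = 0, q u = q v] : Fin 3 → Prop) i := by
      intro i b hi
      fin_cases i
      exacts [(hu b).2 hi, (hv b).2 hi, (huv b).2 hi]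
    rcases two_of_three hzw (key _ _ hz) (key _ _ hw) with ⟨h, h'⟩ | ⟨h, h'⟩ | ⟨h, h'⟩
    · exact ⟨h, h'⟩
    · exact ⟨h, Eq.trans (Eq.symm h') h⟩
    · exact ⟨Eq.trans h' h, h⟩
  rintro w (rfl | rfl)
  exacts [h1.1.symm.trans h2.1, h1.2.symm.trans h2.2]

/-- At the median cut time the earliest branch already has an edge inside the segment and the latest
still has one outside. Both lie in the connected set `P`, disjoint from the middle branch, so `P`
adds 1 to the connectivity `m` of that branch. -/
theorem WidthGE.three_branches {S : Fin 3 → Set V} {U : Set V} {m : ℕ} (hm : 0 < m)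
    (hS : ∀ j, WidthGE F G τ (S j) m) (hSU : ∀ j, S j ⊆ U)
    (hP : ∀ j, ∃ P, ConnectedOn G P ∧ P ⊆ U ∧ Disjoint P (S j) ∧ ∀ i, i ≠ j → S i ⊆ P) :
    WidthGE F G τ U (m + 1) := by
  choose t ht using hS
  have hmono := Tuple.monotone_sort t
  set σ := Tuple.sort t
  obtain ⟨P, hPc, hPU, hPd, hPS⟩ := hP (σ 1)
  obtain ⟨e, he, hea⟩ := exists_mem_of_separated_ne_top ((ht (σ 0)).ne_top hm)
  obtain ⟨f, hf, hfa⟩ := exists_notMem_of_separated_ne_top ((ht (σ 2)).ne_top hm)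
  refine ⟨t (σ 1), (ht (σ 1)).add hPd.symm (hSU _) hPU (connectivityGE_one
    (separated_ne_top hPc ⟨e, coneEdges_mono (hPS _ (by simp)) he, ?_⟩
      ⟨f, coneEdges_mono (hPS _ (by simp)) hf, ?_⟩))⟩
  · exact le_trans hea (hmono (by decide : (0 : Fin 3) ≤ 1))
  · exact fun h => hfa (le_trans h (hmono (by decide : (1 : Fin 3) ≤ 2)))

end Width

/-! ### Width of complete binary trees and of the trees `Y_i` -/

section BinaryTrees

variable {F : Type*} [Field F] {V : Type*} {G : SimpleGraph V}

/-- `S` is the vertex set of a complete binary tree of depth `d` in `G` with root `r`, whose leaves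
are leaves of `G`. -/
inductive IsBinaryTree (G : SimpleGraph V) : ℕ → V → Set V → Prop
  | leaf {v : V} (hv : v ∈ leaves G) : IsBinaryTree G 0 v {v}
  | node {d : ℕ} {r u w : V} {S T : Set V} (hu : IsBinaryTree G d u S) (hw : IsBinaryTree G d w T)
    (hST : Disjoint S T) (hrS : r ∉ S) (hrT : r ∉ T) (hru : G.Adj r u) (hrw : G.Adj r w) :
    IsBinaryTree G (d + 1) r (insert r (S ∪ T))

theorem IsBinaryTree.root_mem {d : ℕ} {r : V} {S : Set V} (h : IsBinaryTree G d r S) : r ∈ S := by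
  cases h
  exacts [rfl, .inl rfl]

theorem ConnectedOn.node {r u w : V} {S T : Set V} (hS : ConnectedOn G S) (hT : ConnectedOn G T)
    (hu : u ∈ S) (hw : w ∈ T) (hru : G.Adj r u) (hrw : G.Adj r w) :
    ConnectedOn G (insert r (S ∪ T)) := by
  rw [← Set.insert_union]
  exact (hS.insert_root hu hru).union hT (.inl rfl) hw hrw

theorem IsBinaryTree.connectedOn {d : ℕ} {r : V} {S : Set V} (h : IsBinaryTree G d r S) :
    ConnectedOn G S := by
  induction h with
  | leaf hv => exact .singleton _
  | node hu hw _ _ _ hru hrw ihu ihw => exact ConnectedOn.node ihu ihw hu.root_mem hw.root_mem hru hrw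

theorem disjoint_node {r : V} {S T R : Set V} (hr : r ∉ R) (hS : Disjoint S R)
    (hT : Disjoint T R) : Disjoint (insert r (S ∪ T)) R := by
  rw [Set.disjoint_insert_left, Set.disjoint_union_left]
  exact ⟨hr, hS, hT⟩

/-- Induction in steps of two levels, from a vertex and from an adjacent pair: the root has only two
children, but the grandchildren supply the three branches needed. -/
theorem IsBinaryTree.widthGE [Finite V] {τ : Sym2 (Option V) × Bool → ℕ}
    (hτ : Set.InjOn τ (coneEdges G Set.univ)) :
    ∀ {d : ℕ} {r : V} {S : Set V}, IsBinaryTree G d r S → WidthGE F G τ S (1 + (d + 1) / 2)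
  | 0, _, _, .leaf _ => widthGE_singleton hτ _
  | 1, r, _, .node (u := u) hu hw _ _ _ hru _ => by
    refine (widthGE_pair hτ hru).mono ?_
    rintro x (rfl | rfl)
    exacts [.inl rfl, .inr (.inl hu.root_mem)]
  | d + 2, r, _, .node (u := u) (w := w) (S := S) (T := T) hu hw hST hrS hrT hru hrw => by
    have hd : 1 + (d + 2 + 1) / 2 = 1 + (d + 1) / 2 + 1 := by omega
    rw [hd]
    cases hu with
    | node ha hb hAB huA huB hua hub =>
    cases hw with
    | node hc he hCE hwC hwE hwc hwe =>
    rename_i a b A B c e C E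
    rw [Set.disjoint_insert_left, Set.disjoint_union_left] at hST
    obtain ⟨huT, hAT, hBT⟩ := hST
    simp only [Set.mem_insert_iff, Set.mem_union, not_or] at hrS
    have hTc : ConnectedOn G (insert w (C ∪ E)) :=
      (IsBinaryTree.node hc he hCE hwC hwE hwc hwe).connectedOn
    have hTs : C ⊆ insert w (C ∪ E) := fun x hx => .inr (.inl hx)
    -- `A` and `B` hang below `u`, and `C` below `w`. Outside `A` or `B` the other two branches are
    -- joined through `u`, `r` and `w`; outside `C` they are joined at `u`.
    refine WidthGE.three_branches (S := ![A, B, C]) (by omega) ?_ ?_ ?_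
    · intro j
      fin_cases j
      exacts [ha.widthGE hτ, hb.widthGE hτ, hc.widthGE hτ]
    · intro j
      fin_cases j
      exacts [fun x hx => .inr (.inl (.inr (.inl hx))), fun x hx => .inr (.inl (.inr (.inr hx))),
        fun x hx => .inr (.inr (hTs hx))]
    · have hrT' : ConnectedOn G (insert r (insert w (C ∪ E))) :=
        hTc.insert_root (.inl rfl) hrw
      intro j
      fin_cases j
      · refine ⟨_, ConnectedOn.node hb.connectedOn hrT' hb.root_mem (.inl rfl) hub hru.symm,
          ?_, ?_, ?_⟩
        · intro x hx
          simp only [Set.mem_insert_iff, Set.mem_union] at hx ⊢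
          tauto
        · exact disjoint_node huA hAB.symm
            (Set.disjoint_insert_left.2 ⟨hrS.2.1, hAT.symm⟩)
        · intro i hi
          fin_cases i
          exacts [(hi rfl).elim, fun x hx => .inr (.inl hx), fun x hx => .inr (.inr (.inr (hTs hx)))]
      · refine ⟨_, ConnectedOn.node ha.connectedOn hrT' ha.root_mem (.inl rfl) hua hru.symm,
          ?_, ?_, ?_⟩
        · intro x hx
          simp only [Set.mem_insert_iff, Set.mem_union] at hx ⊢
          tauto
        · exact disjoint_node huB hAB (Set.disjoint_insert_left.2 ⟨hrS.2.2, hBT.symm⟩)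
        · intro i hi
          fin_cases i
          exacts [fun x hx => .inr (.inl hx), (hi rfl).elim, fun x hx => .inr (.inr (.inr (hTs hx)))]
      · refine ⟨_, ConnectedOn.node ha.connectedOn hb.connectedOn ha.root_mem hb.root_mem hua hub,
          fun x hx => .inr (.inl hx), disjoint_node (fun h => huT (hTs h)) (hAT.mono_right hTs)
            (hBT.mono_right hTs), ?_⟩
        intro i hi
        fin_cases i
        exacts [fun x hx => .inr (.inl hx), fun x hx => .inr (.inr hx), (hi rfl).elim]

theorem widthGE_of_three_isBinaryTree [Finite V] {τ : Sym2 (Option V) × Bool → ℕ}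
    (hτ : Set.InjOn τ (coneEdges G Set.univ)) {d : ℕ} {r : V} {u : Fin 3 → V} {S : Fin 3 → Set V}
    (hS : ∀ j, IsBinaryTree G d (u j) (S j)) (hr : ∀ j, r ∉ S j) (hru : ∀ j, G.Adj r (u j))
    (hd : Pairwise fun i j => Disjoint (S i) (S j)) :
    WidthGE F G τ Set.univ (1 + (d + 1) / 2 + 1) := by
  refine WidthGE.three_branches (S := S) (by omega) (fun j => (hS j).widthGE hτ)
    (fun j => Set.subset_univ _) fun j => ?_
  obtain ⟨a, b, ha, hb, hab⟩ : ∃ a b, a ≠ j ∧ b ≠ j ∧ ∀ i, i ≠ j → i = a ∨ i = b := by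
    revert j; decide
  refine ⟨_, ConnectedOn.node (hS a).connectedOn (hS b).connectedOn (hS a).root_mem
    (hS b).root_mem (hru a) (hru b), Set.subset_univ _, disjoint_node (hr j) (hd ha) (hd hb),
    fun i hi x hx => ?_⟩
  rcases hab i hi with rfl | rfl
  exacts [.inr (.inl hx), .inr (.inr hx)]

/-- The parent map from `branchLeaves G` to `G`, fixing the vertices of `G`. -/
def branchProj (G : SimpleGraph V) : V ⊕ leaves G × Bool → V :=
  Sum.elim id fun x => x.1.1

theorem inr_mem_leaves_branchLeaves (x : leaves G × Bool) :
    Sum.inr x ∈ leaves (branchLeaves G) := by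
  have : (branchLeaves G).neighborSet (Sum.inr x) = {Sum.inl x.1.1} := by
    ext (v | y)
    · simp [branchLeaves]
    · simp [branchLeaves]
  exact (congrArg Set.ncard this).trans (Set.ncard_singleton _)

theorem IsBinaryTree.branchLeaves {d : ℕ} {r : V} {S : Set V} (h : IsBinaryTree G d r S) :
    IsBinaryTree (branchLeaves G) (d + 1) (Sum.inl r) (branchProj G ⁻¹' S) := by
  induction h with
  | @leaf v hv =>
    have := IsBinaryTree.node (r := Sum.inl v)
      (.leaf (inr_mem_leaves_branchLeaves (G := G) (⟨v, hv⟩, true)))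
      (.leaf (inr_mem_leaves_branchLeaves (G := G) (⟨v, hv⟩, false)))
      (by simp) (by simp) (by simp) (by rfl) (by rfl)
    convert this using 1
    ext (x | ⟨x, b⟩)
    · simp [branchProj]
    · cases b <;> simp [branchProj, Subtype.ext_iff]
  | @node d r u w S T hu hw hST hrS hrT hru hrw ihu ihw =>
    -- An inner node has two distinct children and so receives no new vertices.
    have hleaf : r ∉ leaves G := by
      intro h
      obtain ⟨x, hx⟩ := Set.ncard_eq_one.1 h
      have h1 : u = x := by rw [← Set.mem_singleton_iff, ← hx]; exact hru
      have h2 : w = x := by rw [← Set.mem_singleton_iff, ← hx]; exact hrw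
      exact hST.notMem_of_mem_left hu.root_mem (h1.trans h2.symm ▸ hw.root_mem)
    have := IsBinaryTree.node (r := Sum.inl r) ihu ihw (hST.preimage _) hrS hrT hru hrw
    convert this using 1
    ext (x | ⟨x, b⟩)
    · simp [branchProj]
    · have : x.1 ≠ r := fun h => hleaf (h ▸ x.2)
      simp [branchProj, this]

theorem exists_three_isBinaryTree_treeY (n : ℕ) :
    ∃ (r : (treeY (n + 1)).1) (u : Fin 3 → (treeY (n + 1)).1)
      (S : Fin 3 → Set (treeY (n + 1)).1),
      (∀ j, IsBinaryTree (treeY (n + 1)).2 n (u j) (S j)) ∧ (∀ j, r ∉ S j) ∧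
      (∀ j, (treeY (n + 1)).2.Adj r (u j)) ∧ Pairwise fun i j => Disjoint (S i) (S j) := by
  induction n with
  | zero =>
    refine ⟨Sum.inl 0, Sum.inr, fun j => {Sum.inr j}, fun j => .leaf ?_, fun _ => Sum.inl_ne_inr,
      fun j => Or.inl ⟨rfl, rfl⟩, fun i j hij =>
      Set.disjoint_singleton.2 (Sum.inr_injective.ne hij)⟩
    have : (completeBipartiteGraph (Fin 1) (Fin 3)).neighborSet (Sum.inr j) = {Sum.inl 0} := by
      ext (x | x)
      · simp [Fin.eq_zero x]
      · simp
    exact (congrArg Set.ncard this).trans (Set.ncard_singleton _)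
  | succ n ih =>
    obtain ⟨r, u, S, hS, hr, hru, hd⟩ := ih
    exact ⟨Sum.inl r, fun j => Sum.inl (u j), fun j => branchProj _ ⁻¹' S j,
      fun j => (hS j).branchLeaves, hr, hru, fun i j hij => (hd hij).preimage _⟩

end BinaryTrees

/-! ### Local constraint codes in terms of potentials -/

theorem SimpleGraph.Reachable.invariant {W : Type*} {T : SimpleGraph W} {P : W → Prop}
    (hP : ∀ x y, T.Adj x y → P x → P y) {x y : W} (h : T.Reachable x y) : P x → P y := by
  obtain ⟨p⟩ := h
  induction p with
  | nil => exact id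
  | cons a _ ih => exact fun hx => ih (hP _ _ a hx)

theorem SimpleGraph.Walk.eq_of_forall_mem_edges {W X : Type*} {T : SimpleGraph W} {f : W → X}
    {x y : W} (p : T.Walk x y) (h : ∀ a b, s(a, b) ∈ p.edges → f a = f b) : f x = f y := by
  induction p with
  | nil => rfl
  | cons a p ih =>
    exact (h _ _ (by simp)).trans (ih fun a b hab => h a b (by simp [hab]))

theorem coneEdges_univ {V : Type*} {G : SimpleGraph V} :
    coneEdges G Set.univ = E(barGraph G) := by
  ext ⟨e, b⟩
  constructor
  · rintro (⟨v, -, rfl⟩ | ⟨u, -, v, -, a, rfl⟩)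
    exacts [mem_edgeSet_barGraph (cone_adj_none v) b, mem_edgeSet_barGraph (x := some u) (y := some v) a b]
  · rintro ⟨x, y, a, rfl⟩
    rcases x with _ | x <;> rcases y with _ | y
    · exact a.elim
    · exact .inl ⟨y, trivial, rfl⟩
    · exact .inl ⟨x, trivial, Sym2.eq_swap⟩
    · exact .inr ⟨x, trivial, y, trivial, a, rfl⟩

theorem mem_coneEdges_univ {V : Type*} {G : SimpleGraph V} (e : E(barGraph G)) :
    e.1 ∈ coneEdges G Set.univ := by
  rw [coneEdges_univ]
  exact e.2

section Constraints

variable {F : Type*} [Field F]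

theorem mem_ker_localConfiguration {I : Type*} {C : Submodule F (I → F)}
    {T : TreeDecomposition I} {v : T.V} {c : C} :
    c ∈ LinearMap.ker (localConfiguration C T v) ↔
      (∀ i, T.ω i = v → c.1 i = 0) ∧ ∀ e ∈ T.T.incidenceSet v, c ∈ splitSubcode C T e := by
  rw [localConfiguration, LinearMap.ker_prod, LinearMap.ker_pi, Submodule.mem_inf,
    Submodule.mem_iInf]
  refine and_congr ⟨fun h i hi => congrFun h ⟨i, hi⟩, fun h => funext fun i => h i.1 i.2⟩ ?_
  simp

/-- Each component of `T - e` has its indices entirely inside or outside `A`, so truncation to `A`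
keeps or kills each summand of `c`. -/
theorem exists_restrict_of_mem_splitSubcode {I : Type*} {C : Submodule F (I → F)}
    {T : TreeDecomposition I} {e : Sym2 T.V} {A : Set I}
    (hA : ∀ i j, (T.T.deleteEdges {e}).Reachable (T.ω i) (T.ω j) → i ∈ A → j ∈ A) {c : C}
    (hc : c ∈ splitSubcode C T e) :
    ∃ d ∈ C, ∀ i, (i ∈ A → d i = c.1 i) ∧ (i ∉ A → d i = 0) := by
  have hc' : c.1 ∈ ⨆ K : (T.T.deleteEdges {e}).ConnectedComponent,
    crossSection C (T.ω ⁻¹' K.supp) := hc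
  generalize c.1 = x at hc'
  refine Submodule.iSup_induction _ (motive := fun x =>
    ∃ d ∈ C, ∀ i, (i ∈ A → d i = x i) ∧ (i ∉ A → d i = 0)) hc' ?_ ⟨0, C.zero_mem, by simp⟩ ?_
  · rintro K x ⟨hx, hx0⟩
    by_cases h : ∃ i ∈ A, T.ω i ∈ K.supp
    · obtain ⟨i, hi, hiK⟩ := h
      refine ⟨x, hx, fun j => ⟨fun _ => rfl, fun hj => hx0 j fun hjK => hj (hA i j ?_ hi)⟩⟩
      exact SimpleGraph.ConnectedComponent.exact (hiK.trans (Eq.symm hjK))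
    · push Not at h
      exact ⟨0, C.zero_mem, fun i => ⟨fun hi => (hx0 i (h i hi)).symm, fun _ => rfl⟩⟩
  · rintro x y ⟨d, hd, h⟩ ⟨d', hd', h'⟩
    refine ⟨d + d', C.add_mem hd hd', fun i => ⟨fun hi => ?_, fun hi => ?_⟩⟩
    · simp [(h i).1 hi, (h' i).1 hi]
    · simp [(h i).2 hi, (h' i).2 hi]

theorem le_constraintComplexity {I : Type*} (C : Submodule F (I → F)) (T : TreeDecomposition I)
    (v : T.V) : Module.finrank F (localConstraint C T v) ≤ constraintComplexity C T := by
  have := T.finite_V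
  exact le_ciSup (Set.finite_range fun v => Module.finrank F (localConstraint C T v)).bddAbove v

theorem constraintComplexity_le {I : Type*} {C : Submodule F (I → F)} {T : TreeDecomposition I}
    {k : ℕ} (h : ∀ v, Module.finrank F (localConstraint C T v) ≤ k) :
    constraintComplexity C T ≤ k :=
  ciSup_le' h

variable {V : Type*} [Finite V] {G : SimpleGraph V} {D : EdgeOrientation (barGraph G)}
  {T : TreeDecomposition E(barGraph G)}

/-- The potentials on `G` whose codewords have the zero local configuration at `v`. -/
def potentialKer (F : Type*) [Field F] (D : EdgeOrientation (barGraph G))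
    (T : TreeDecomposition E(barGraph G)) (v : T.V) : Submodule F (V → F) :=
  LinearMap.ker (localConfiguration (graphCode F D) T v ∘ₗ potentialCode F D)

/-- Scaling by -1 supplies negatives in `N`, so rank-nullity applies although the codomain is
declared only as a monoid. -/
theorem finrank_range_add_finrank_ker_of_addCommMonoid {M N : Type*} [AddCommGroup M] [Module F M]
    [FiniteDimensional F M] [AddCommMonoid N] [Module F N] (f : M →ₗ[F] N) :
    Module.finrank F (LinearMap.range f) + Module.finrank F (LinearMap.ker f) =
      Module.finrank F M :=
  letI := Module.addCommMonoidToAddCommGroup F (M := N)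
  LinearMap.finrank_range_add_finrank_ker f

theorem finrank_localConstraint_add (v : T.V) :
    Module.finrank F (localConstraint (graphCode F D) T v) +
      Module.finrank F (potentialKer F D T v) = Nat.card V := by
  have h := finrank_range_add_finrank_ker_of_addCommMonoid
    (localConfiguration (graphCode F D) T v ∘ₗ potentialCode F D)
  rwa [LinearMap.range_comp_of_range_eq_top _
    (LinearMap.range_eq_top.2 (potentialCode_surjective D)), finrank_potentials] at h

theorem potentialKer_le_separated {v : T.V} {e : Sym2 T.V} (he : e ∈ T.T.incidenceSet v)
    {A : Set (Sym2 (Option V) × Bool)}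
    (hA : ∀ i j : E(barGraph G), (T.T.deleteEdges {e}).Reachable (T.ω i) (T.ω j) →
      i.1 ∈ A → j.1 ∈ A) :
    potentialKer F D T v ≤ separated F G Set.univ A := by
  intro p hp
  have hp' := ((mem_ker_localConfiguration (c := potentialCode F D p)).1 hp).2 e he
  obtain ⟨d, hd, h⟩ := exists_restrict_of_mem_splitSubcode (A := {i | i.1 ∈ A}) hA hp'
  obtain ⟨q, hq⟩ := potentialCode_surjective D ⟨d, hd⟩
  have hq' : ∀ i, (potentialCode F D q).1 i = d i := fun i => by rw [hq]
  have key : ∀ {x y : Option V}, (cone G).Adj x y → ∀ b,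
      ((s(x, y), b) ∈ A → extendZero F V q x - extendZero F V q y =
        extendZero F V p x - extendZero F V p y) ∧
      ((s(x, y), b) ∉ A → extendZero F V q x - extendZero F V q y = 0) := by
    intro x y a b
    have hi := h ⟨(s(x, y), b), mem_edgeSet_barGraph a b⟩
    constructor
    · intro hb
      exact (potentialCode_eq_iff D p q rfl).1 ((hq' _).trans (hi.1 hb))
    · intro hb
      have := (potentialCode_eq_iff D 0 q rfl).1
        (((hq' _).trans (hi.2 hb)).trans (by simp))
      simpa using this
  refine ⟨q, fun v _ b => ⟨fun hb => ?_, fun hb => ?_⟩,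
    fun u _ v _ a b => ⟨fun hb => ?_, fun hb => ?_⟩⟩
  · simpa using (key (cone_adj_none v) b).1 hb
  · simpa using (key (cone_adj_none v) b).2 hb
  · simpa using (key (x := some u) (y := some v) a b).1 hb
  · simpa [sub_eq_zero] using (key (x := some u) (y := some v) a b).2 hb

/-! ### Lower bounds on the constraint complexity -/

theorem le_constraintComplexity_of_isPathDecomposition (hT : T.IsPathDecomposition) {m : ℕ}
    (hm : 0 < m) (h : ∀ τ : Sym2 (Option V) × Bool → ℕ, Set.InjOn τ (coneEdges G Set.univ) →
      WidthGE F G τ Set.univ m) : m ≤ constraintComplexity (graphCode F D) T := by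
  classical
  obtain ⟨⟨φ⟩, hω⟩ := hT
  -- Position along the path; the value 0 off the edge set is harmless, as injectivity is only
  -- needed on edges.
  let τ : Sym2 (Option V) × Bool → ℕ := fun x =>
    if hx : x ∈ E(barGraph G) then (φ (T.ω ⟨x, hx⟩)).val else 0
  have hτ : ∀ i : E(barGraph G), τ i.1 = (φ (T.ω i)).val := fun i => dif_pos i.2
  obtain ⟨k, hk⟩ := h τ <| by
    rw [coneEdges_univ]
    intro x hx y hy hxy
    rw [hτ ⟨x, hx⟩, hτ ⟨y, hy⟩] at hxy
    exact congrArg Subtype.val (hω.1 (φ.injective (Fin.ext hxy)))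
  -- Positive connectivity leaves an edge beyond position `k`, so the path does have an edge from
  -- `k` to `k + 1`.
  obtain ⟨x, hx, hxk⟩ := exists_notMem_of_separated_ne_top (hk.ne_top hm)
  rw [coneEdges_univ] at hx
  have hkn : k + 1 < Nat.card E(barGraph G) := by
    have h1 : ¬ τ x ≤ k := hxk
    rw [hτ ⟨x, hx⟩] at h1
    have := (φ (T.ω ⟨x, hx⟩)).2
    omega
  let v := φ.symm ⟨k, by omega⟩
  let w := φ.symm ⟨k + 1, hkn⟩
  have hvw : T.T.Adj v w := by
    rw [← φ.map_adj_iff, SimpleGraph.pathGraph_adj]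
    left
    simp only [v, w, RelIso.apply_symm_apply]
  have hle := potentialKer_le_separated (F := F) (D := D) (T := T) (v := v) (e := s(v, w))
    (A := {e | τ e ≤ k}) ⟨hvw, Sym2.mem_mk_left v w⟩ <| by
    intro i j hij
    simp only [Set.mem_ofPred_eq, hτ]
    refine hij.invariant (P := fun x => (φ x).val ≤ k) fun x y hxy hx => ?_
    rw [SimpleGraph.deleteEdges_adj, ← φ.map_adj_iff, SimpleGraph.pathGraph_adj] at hxy
    by_contra hy
    refine hxy.2 ?_
    have h1 : x = v := by
      rw [← φ.symm_apply_apply x]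
      exact congrArg φ.symm (Fin.ext (show (φ x).val = k by omega))
    have h2 : y = w := by
      rw [← φ.symm_apply_apply y]
      exact congrArg φ.symm (Fin.ext (show (φ y).val = k + 1 by omega))
    rw [h1, h2]
    rfl
  have h1 := Submodule.finrank_mono hle
  have h2 := finrank_localConstraint_add (F := F) (D := D) v
  refine le_trans ?_ (le_constraintComplexity _ _ v)
  unfold ConnectivityGE at hk
  omega

/-- Otherwise every kernel has codimension at most 1. A tree edge between two occupied vertices has
a separated space of codimension at least 1 containing the kernels at both ends, so all three agree.
Then one kernel serves all occupied vertices; its potentials vanish on every edge to the extra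
vertex, so it is zero, which contradicts `2 ≤ Nat.card V`. -/
theorem two_le_constraintComplexity (hG : ConnectedOn G Set.univ) (hV : 2 ≤ Nat.card V) :
    2 ≤ constraintComplexity (graphCode F D) T := by
  classical
  by_contra! hlt
  have hfin : ∀ v, Nat.card V ≤ Module.finrank F (potentialKer F D T v) + 1 := fun v => by
    have h1 := finrank_localConstraint_add (F := F) (D := D) v
    have h2 := le_constraintComplexity (graphCode F D) T v
    omega
  have heq : ∀ i j, potentialKer F D T (T.ω i) = potentialKer F D T (T.ω j) := by
    intro i j
    obtain ⟨p, hp⟩ := T.isTree.1.exists_isPath (T.ω i) (T.ω j)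
    refine p.eq_of_forall_mem_edges fun a b hab => ?_
    let A : Set (Sym2 (Option V) × Bool) := {x | ∃ hx : x ∈ E(barGraph G),
      (T.T.deleteEdges {s(a, b)}).Reachable (T.ω i) (T.ω ⟨x, hx⟩)}
    have hA : ∀ k l : E(barGraph G), (T.T.deleteEdges {s(a, b)}).Reachable (T.ω k) (T.ω l) →
        k.1 ∈ A → l.1 ∈ A := fun k l hkl ⟨_, hk⟩ => ⟨l.2, hk.trans hkl⟩
    have hadj : T.T.Adj a b := p.adj_of_mem_edges hab
    have htop : separated F G Set.univ A ≠ ⊤ := by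
      refine separated_ne_top hG ⟨i.1, mem_coneEdges_univ i, i.2, .rfl⟩
        ⟨j.1, mem_coneEdges_univ j, ?_⟩
      rintro ⟨_, hj⟩
      -- A walk avoiding the edge would contain a path avoiding it, but the path in a tree is
      -- unique.
      obtain ⟨q, hq⟩ := SimpleGraph.reachable_deleteEdges_iff_exists_walk.1 hj
      have := congrArg Subtype.val ((T.isTree.2.subsingleton_path _ _).elim ⟨p, hp⟩ q.toPath)
      exact hq (q.edges_toPath_subset_edges (this ▸ hab))
    have hlt := Submodule.finrank_lt htop
    rw [finrank_potentials] at hlt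
    have key : ∀ v, s(a, b) ∈ T.T.incidenceSet v →
        potentialKer F D T v = separated F G Set.univ A := fun v hv => by
      refine Submodule.eq_of_le_of_finrank_le (potentialKer_le_separated hv hA) ?_
      have := hfin v
      omega
    exact (key a ⟨hadj, Sym2.mem_mk_left a b⟩).trans (key b ⟨hadj, Sym2.mem_mk_right a b⟩).symm
  have hne : Nonempty V := (Nat.card_pos_iff.1 (by omega)).1
  obtain ⟨v₀⟩ := hne
  let apex : V → E(barGraph G) := fun v =>
    ⟨(s(none, some v), true), mem_edgeSet_barGraph (cone_adj_none v) true⟩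
  have hbot : potentialKer F D T (T.ω (apex v₀)) = ⊥ := by
    rw [eq_bot_iff]
    refine fun p hp => funext fun v => ?_
    rw [heq _ (apex v)] at hp
    have h0 := ((mem_ker_localConfiguration (c := potentialCode F D p)).1 hp).1 (apex v) rfl
    have := (potentialCode_eq_iff D 0 p rfl).1 (h0.trans (by simp))
    simpa using this
  have := hfin (T.ω (apex v₀))
  rw [hbot, finrank_bot] at this
  omega

/-! ### Upper bounds from bags -/

theorem finrank_localConstraint_le {v : T.V} {X : Set V} [DecidableEq V]
    (h : ∀ u ∉ X, Pi.single u 1 ∈ potentialKer F D T v) :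
    Module.finrank F (localConstraint (graphCode F D) T v) ≤ X.ncard := by
  have := Fintype.ofFinite V
  let f : (V → F) →ₗ[F] (X → F) := LinearMap.funLeft F F Subtype.val
  have hle : LinearMap.ker f ≤ potentialKer F D T v := by
    intro p hp
    rw [pi_eq_sum_univ' p]
    refine Submodule.sum_mem _ fun u _ => ?_
    by_cases hu : u ∈ X
    · have : p u = 0 := congrFun hp ⟨u, hu⟩
      simp [this]
    · exact Submodule.smul_mem _ _ (by convert h u hu using 1)
  have h1 := Submodule.finrank_mono hle
  have h2 := LinearMap.finrank_range_add_finrank_ker f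
  have h3 := Submodule.finrank_le (LinearMap.range f)
  have h4 := finrank_localConstraint_add (F := F) (D := D) v
  rw [finrank_potentials] at h2 h3
  rw [Nat.card_coe_set_eq] at h3
  omega

/-- The codeword of the indicator of `u` is supported on the edges at `u`. These lie in a single
component of `T - e`, so the codeword belongs to one cross-section and its state is zero. -/
theorem single_mem_potentialKer [DecidableEq V] {v : T.V} {u : V}
    (h : ∀ i : E(barGraph G), some u ∈ i.1.1 → T.ω i ≠ v)
    (h' : ∀ e ∈ T.T.incidenceSet v, ∀ i j : E(barGraph G), some u ∈ i.1.1 → some u ∈ j.1.1 →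
      (T.T.deleteEdges {e}).Reachable (T.ω i) (T.ω j)) :
    Pi.single u 1 ∈ potentialKer F D T v := by
  have h0 : ∀ i : E(barGraph G), some u ∉ i.1.1 →
      (potentialCode F D (Pi.single u 1)).1 i = 0 := by
    intro i hi
    have key : ∀ x, x ∈ i.1.1 → extendZero F V (Pi.single u 1) x = 0 := by
      rintro (_ | x) hx
      · rfl
      · have : x ≠ u := by rintro rfl; exact hi hx
        simp [this]
    have hi' := (D.isLink i).2
    rw [potentialCode_apply, key _ (hi' ▸ Sym2.mem_mk_left _ _),
      key _ (hi' ▸ Sym2.mem_mk_right _ _), sub_zero]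
  refine mem_ker_localConfiguration.2 ⟨fun i hi => h0 i fun hu => h i hu hi, fun e he => ?_⟩
  let i₀ : E(barGraph G) :=
    ⟨(s(none, some u), true), mem_edgeSet_barGraph (cone_adj_none u) true⟩
  refine Submodule.mem_iSup_of_mem (SimpleGraph.connectedComponentMk _ (T.ω i₀))
    ⟨(potentialCode F D _).2, fun i hi => h0 i fun hu => hi ?_⟩
  exact SimpleGraph.ConnectedComponent.sound (h' e he i i₀ hu (Sym2.mem_mk_right _ _))

end Constraints

/-! ### Rooted trees -/

section RootedTrees

/-- `G` is a tree with root `r` and parent map `par`. -/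
structure IsRootedTree {V : Type*} (G : SimpleGraph V) (par : V → V) (r : V) : Prop where
  connected : G.Connected
  root : par r = r
  adj : ∀ u v, G.Adj u v → par u = v ∨ par v = u

variable {V : Type*} {G : SimpleGraph V} {par : V → V} {r : V}

/-- Each edge is charged to an endpoint whose parent is the other one, never to the root, so there
are at most `|V| - 1` edges. -/
theorem IsRootedTree.isTree [Finite V] (h : IsRootedTree G par r) : G.IsTree := by
  classical
  rw [SimpleGraph.isTree_iff_connected_and_card]
  refine ⟨h.connected, le_antisymm ?_ h.connected.card_vert_le_card_edgeSet_add_one⟩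
  have hex : ∀ e : G.edgeSet, ∃ v, e.1 = s(v, par v) := by
    rintro ⟨e, he⟩
    induction e with | _ u v
    rcases h.adj u v he with rfl | rfl
    exacts [⟨u, rfl⟩, ⟨v, Sym2.eq_swap⟩]
  choose f hf using hex
  have hfr : ∀ e, f e ≠ r := by
    intro e he
    have := e.2
    rw [hf, he, h.root] at this
    exact G.loopless.irrefl r this
  have hinj : Function.Injective fun e => (⟨f e, hfr e⟩ : ({r}ᶜ : Set V)) := by
    intro e e' hee
    have : f e = f e' := congrArg Subtype.val hee
    exact Subtype.ext ((hf e).trans (this ▸ (hf e').symm))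
  have h1 := Nat.card_le_card_of_injective _ hinj
  have h2 := Set.ncard_add_ncard_compl ({r} : Set V)
  rw [Nat.card_coe_set_eq ({r}ᶜ : Set V)] at h1
  rw [Set.ncard_singleton] at h2
  omega

theorem SimpleGraph.Connected.connectedOn_univ (h : G.Connected) : ConnectedOn G Set.univ :=
  fun _ hX u _ v _ => (h.preconnected u v).invariant fun x y => hX x trivial y trivial

theorem isRootedTree_completeBipartiteGraph :
    IsRootedTree (completeBipartiteGraph (Fin 1) (Fin 3)) (fun _ => Sum.inl 0) (Sum.inl 0) where
  connected := by
    have : ∀ x, (completeBipartiteGraph (Fin 1) (Fin 3)).Reachable (Sum.inl 0) x := by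
      rintro (x | x)
      · rw [Fin.eq_zero x]
      · exact SimpleGraph.Adj.reachable (by simp)
    exact (SimpleGraph.connected_iff_exists_forall_reachable _).2 ⟨_, this⟩
  root := rfl
  adj := by
    rintro (u | u) (v | v) h
    · simp at h
    · exact .inr (by rw [Fin.eq_zero u])
    · exact .inl (by rw [Fin.eq_zero v])
    · simp at h

theorem IsRootedTree.branchLeaves (h : IsRootedTree G par r) :
    IsRootedTree (branchLeaves G) (Sum.elim (fun v => Sum.inl (par v)) fun x => Sum.inl x.1.1)
      (Sum.inl r) where
  connected := by
    let f : G →g _root_.branchLeaves G := ⟨Sum.inl, id⟩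
    have hf : ∀ v, (_root_.branchLeaves G).Reachable (Sum.inl r) (Sum.inl v) := fun v =>
      (h.connected.preconnected r v).map f
    refine (SimpleGraph.connected_iff_exists_forall_reachable _).2 ⟨Sum.inl r, ?_⟩
    rintro (v | x)
    · exact hf v
    · refine (hf x.1.1).trans (SimpleGraph.Adj.reachable ?_)
      rfl
  root := congrArg Sum.inl h.root
  adj := by
    rintro (u | u) (v | v) a
    · exact (h.adj u v a).imp (congrArg Sum.inl) (congrArg Sum.inl)
    · exact .inr (congrArg Sum.inl (Eq.symm a))
    · exact .inl (congrArg Sum.inl (Eq.symm a))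
    · exact a.elim

end RootedTrees

/-! ### The treewidth -/

section Treewidth

variable {F : Type*} [Field F] {V : Type} [Finite V] {G : SimpleGraph V} {par : V → V} {r : V}

/-- Place at `v` its edges to the extra vertex and to its parent. The edges at `u` then sit at `u`
and its children, a star that survives deleting an edge at `v` unless `u` is `v` or `par v`. -/
theorem exists_constraintComplexity_le_two (h : IsRootedTree G par r)
    (D : EdgeOrientation (barGraph G)) :
    ∃ T : TreeDecomposition E(barGraph G), constraintComplexity (graphCode F D) T ≤ 2 := by
  classical
  have hex : ∀ e : E(barGraph G), ∃ v, e.1.1 = s(none, some v) ∨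
      G.Adj v (par v) ∧ e.1.1 = s(some v, some (par v)) := by
    intro e
    rcases mem_coneEdges_univ e with ⟨v, -, hv⟩ | ⟨u, -, v, -, a, huv⟩
    · exact ⟨v, .inl hv⟩
    · rcases h.adj u v a with rfl | rfl
      exacts [⟨u, .inr ⟨a, huv⟩⟩, ⟨v, .inr ⟨a.symm, huv.trans Sym2.eq_swap⟩⟩]
  choose ω hω using hex
  have key : ∀ i : E(barGraph G), ∀ u, some u ∈ i.1.1 →
      ω i = u ∨ par (ω i) = u ∧ G.Adj (ω i) u := by
    intro i u hu
    rcases hω i with hi | ⟨a, hi⟩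
    · rw [hi] at hu
      simp only [Sym2.mem_iff, reduceCtorEq, Option.some.injEq, false_or] at hu
      exact .inl hu.symm
    · rw [hi] at hu
      simp only [Sym2.mem_iff, Option.some.injEq] at hu
      rcases hu with rfl | hu
      · exact .inl rfl
      · exact .inr ⟨hu.symm, hu ▸ a⟩
  refine ⟨⟨V, inferInstance, G, h.isTree, ω⟩, constraintComplexity_le fun v => ?_⟩
  refine (finrank_localConstraint_le (X := {v, par v}) fun u hu => ?_).trans
    ((Set.ncard_insert_le _ _).trans (by rw [Set.ncard_singleton]))
  simp only [Set.mem_insert_iff, Set.mem_singleton_iff, not_or] at hu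
  have hne : ∀ i : E(barGraph G), some u ∈ i.1.1 → ω i ≠ v := by
    rintro i hi rfl
    rcases key i u hi with h' | ⟨h', -⟩
    exacts [hu.1 h'.symm, hu.2 h'.symm]
  refine single_mem_potentialKer hne fun e he i j hi hj => ?_
  have hreach : ∀ i : E(barGraph G), some u ∈ i.1.1 →
      (G.deleteEdges {e}).Reachable (ω i) u := by
    intro i hi
    rcases key i u hi with h' | ⟨-, h'⟩
    · rw [h']
    · refine SimpleGraph.Adj.reachable ((SimpleGraph.deleteEdges_adj ..).2 ⟨h', fun hmem => ?_⟩)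
      have hv : v ∈ s(ω i, u) := (Set.mem_singleton_iff.1 hmem) ▸ he.2
      rcases Sym2.mem_iff.1 hv with h'' | h''
      exacts [hne i hi h''.symm, hu.1 h''.symm]
  exact (hreach i hi).trans (hreach j hj).symm

theorem codeTreewidth_eq_two (h : IsRootedTree G par r) (hV : 2 ≤ Nat.card V)
    (D : EdgeOrientation (barGraph G)) : codeTreewidth (graphCode F D) = 2 := by
  obtain ⟨T, hT⟩ := exists_constraintComplexity_le_two (F := F) h D
  have hmem : constraintComplexity (graphCode F D) T ∈ {k | ∃ T, constraintComplexity
    (graphCode F D) T = k} := ⟨T, rfl⟩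
  refine le_antisymm ((Nat.sInf_le hmem).trans hT) (le_csInf ⟨_, hmem⟩ ?_)
  rintro _ ⟨T, rfl⟩
  exact two_le_constraintComplexity h.connected.connectedOn_univ hV

end Treewidth

/-! ### Path decompositions from interval representations -/

section Intervals

theorem reachable_pathGraph_deleteEdges {n : ℕ} {k : Fin n} {e : Sym2 (Fin n)} (he : k ∈ e)
    {a b : Fin n} (hab : a ≤ b) (h : ∀ c, a ≤ c → c ≤ b → c ≠ k) :
    ((SimpleGraph.pathGraph n).deleteEdges {e}).Reachable a b := by
  obtain ⟨b, hb⟩ := b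
  induction b with
  | zero =>
    rw [Fin.ext (Nat.le_zero.1 hab) (b := ⟨0, hb⟩)]
  | succ b ih =>
    rcases Nat.lt_or_eq_of_le (show a.val ≤ b + 1 from hab) with hlt | heq
    · have hb' : b < n := by omega
      have hab' : a ≤ ⟨b, hb'⟩ := Nat.lt_succ_iff.1 hlt
      refine (ih hb' hab' fun c hc hcb => h c hc (hcb.trans (Nat.le_succ b))).trans
        (SimpleGraph.Adj.reachable ((SimpleGraph.deleteEdges_adj ..).2
          ⟨SimpleGraph.pathGraph_adj.2 (.inl rfl), fun hmem => ?_⟩))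
      have hk : k ∈ s((⟨b, hb'⟩ : Fin n), ⟨b + 1, hb⟩) := (Set.mem_singleton_iff.1 hmem) ▸ he
      rcases Sym2.mem_iff.1 hk with h' | h'
      · exact h _ hab' (Nat.le_succ b) h'.symm
      · exact h _ hab le_rfl h'.symm
    · rw [Fin.ext heq (b := ⟨b + 1, hb⟩)]

theorem isTree_pathGraph {n : ℕ} (hn : 0 < n) : (SimpleGraph.pathGraph n).IsTree := by
  obtain ⟨n, rfl⟩ := Nat.exists_eq_add_of_lt hn
  rw [zero_add]
  refine IsRootedTree.isTree (par := fun k => ⟨k.val - 1, by omega⟩) (r := 0)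
    ⟨SimpleGraph.pathGraph_connected n, rfl, fun u v h => ?_⟩
  rw [SimpleGraph.pathGraph_adj] at h
  rcases h with h | h
  · exact .inr (Fin.ext (show v.val - 1 = u.val by omega))
  · exact .inl (Fin.ext (show u.val - 1 = v.val by omega))

/-- A representation of `G` by intervals `[l v, r v]`, with those of adjacent vertices intersecting,
such that every point lies in at most `b` intervals. -/
structure IsIntervalRep {V : Type*} (G : SimpleGraph V) (l r : V → ℕ) (b : ℕ) : Prop where
  le : ∀ v, l v ≤ r v
  adj : ∀ u v, G.Adj u v → l u ≤ r v
  overlap : ∀ t, {v | l v ≤ t ∧ t ≤ r v}.ncard ≤ b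

variable {F : Type*} [Field F] {V : Type} [Finite V] {G : SimpleGraph V} {l r : V → ℕ} {b : ℕ}

/-- Order the edges by a time common to the intervals of their endpoints in `G`. A vertex whose
interval misses the time of the edge `m` has all its edges on one side of `m`, so only intervals
through that time count. -/
theorem IsIntervalRep.exists_path [Nonempty V] (h : IsIntervalRep G l r b)
    (D : EdgeOrientation (barGraph G)) :
    ∃ T : TreeDecomposition E(barGraph G), T.IsPathDecomposition ∧
      constraintComplexity (graphCode F D) T ≤ b := by
  classical
  have hex : ∀ e : E(barGraph G), ∃ t, ∀ u, some u ∈ e.1.1 → l u ≤ t ∧ t ≤ r u := by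
    intro e
    rcases mem_coneEdges_univ e with ⟨v, -, hv⟩ | ⟨u, -, v, -, a, huv⟩
    · refine ⟨l v, fun u hu => ?_⟩
      rw [hv] at hu
      simp only [Sym2.mem_iff, reduceCtorEq, Option.some.injEq, false_or] at hu
      rw [hu]
      exact ⟨le_rfl, h.le v⟩
    · refine ⟨max (l u) (l v), fun w hw => ?_⟩
      rw [huv] at hw
      simp only [Sym2.mem_iff, Option.some.injEq] at hw
      rcases hw with rfl | rfl
      · exact ⟨le_max_left _ _, max_le (h.le _) (h.adj _ _ a.symm)⟩
      · exact ⟨le_max_right _ _, max_le (h.adj _ _ a) (h.le _)⟩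
  choose key hkey using hex
  let ε := Finite.equivFin E(barGraph G)
  let σ := Tuple.sort (key ∘ ε.symm)
  have hmono : Monotone ((key ∘ ε.symm) ∘ σ) := Tuple.monotone_sort _
  let ω : E(barGraph G) ≃ Fin (Nat.card E(barGraph G)) := ε.trans σ.symm
  have hω : ∀ i j, ω i ≤ ω j → key i ≤ key j := by
    intro i j hij
    simpa only [Function.comp_apply, ω, Equiv.trans_apply, Equiv.apply_symm_apply,
      Equiv.symm_apply_apply] using hmono hij
  have hpos : 0 < Nat.card E(barGraph G) := by
    obtain ⟨v⟩ := ‹Nonempty V›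
    have : Nonempty E(barGraph G) :=
      ⟨⟨(s(none, some v), true), mem_edgeSet_barGraph (cone_adj_none v) true⟩⟩
    exact Nat.card_pos
  refine ⟨⟨_, inferInstance, _, isTree_pathGraph hpos, ω⟩, ⟨⟨.refl⟩, ω.bijective⟩,
    constraintComplexity_le fun k => ?_⟩
  obtain ⟨m, rfl⟩ := ω.surjective k
  refine (finrank_localConstraint_le (X := {v | l v ≤ key m ∧ key m ≤ r v}) fun u hu => ?_).trans
    (h.overlap _)
  have hne : ∀ i : E(barGraph G), some u ∈ i.1.1 → ω i ≠ ω m := by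
    intro i hi him
    exact hu (ω.injective him ▸ hkey i u hi)
  refine single_mem_potentialKer hne fun e he i j hi hj => ?_
  have hside : (∀ i : E(barGraph G), some u ∈ i.1.1 → ω i < ω m) ∨
      ∀ i : E(barGraph G), some u ∈ i.1.1 → ω m < ω i := by
    by_cases hlt : key m < l u
    · right
      intro i hi
      by_contra! hle
      have h1 := hω _ _ hle
      have h2 := (hkey i u hi).1
      omega
    · left
      intro i hi
      by_contra! hle
      have h1 := hω _ _ hle
      have h2 := (hkey i u hi).2
      exact hu ⟨by omega, by omega⟩
  have main : ∀ i j : E(barGraph G), some u ∈ i.1.1 → some u ∈ j.1.1 → ω i ≤ ω j →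
      ((SimpleGraph.pathGraph _).deleteEdges {e}).Reachable (ω i) (ω j) := by
    intro i j hi hj hij
    refine reachable_pathGraph_deleteEdges he.2 hij fun c hc hc' => ?_
    rcases hside with hs | hs
    exacts [(hc'.trans_lt (hs j hj)).ne, ((hs i hi).trans_le hc).ne']
  rcases le_total (ω i) (ω j) with hij | hij
  exacts [main i j hi hj hij, (main j i hj hi hij).symm]

/-- Stretch each time into a block of `M + 1` times. New vertices become distinct points in the
first block of their parent's interval, so at most one of them is met at any time. -/
theorem IsIntervalRep.branchLeaves (h : IsIntervalRep G l r b) :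
    ∃ l' r', IsIntervalRep (branchLeaves G) l' r' (b + 1) := by
  classical
  let M := Nat.card (leaves G × Bool)
  let idx := Finite.equivFin (leaves G × Bool)
  have hidx : ∀ x, (idx x).val < M := fun x => (idx x).2
  refine ⟨Sum.elim (fun v => (M + 1) * l v) fun x => (M + 1) * l x.1 + idx x,
    Sum.elim (fun v => (M + 1) * r v + M) fun x => (M + 1) * l x.1 + idx x, ?_, ?_, ?_⟩
  · rintro (v | x)
    · exact (Nat.mul_le_mul_left _ (h.le v)).trans (Nat.le_add_right _ _)
    · exact le_rfl
  · rintro (u | u) (v | v) a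
    · exact (Nat.mul_le_mul_left _ (h.adj u v a)).trans (Nat.le_add_right _ _)
    · cases (a : u = v.1.1)
      exact Nat.le_add_right _ _
    · cases (a : v = u.1.1)
      exact Nat.add_le_add (Nat.mul_le_mul_left _ (h.le _)) (hidx u).le
    · exact a.elim
  · intro t
    have hsub : {v : V ⊕ leaves G × Bool |
        Sum.elim (fun v => (M + 1) * l v) (fun x => (M + 1) * l x.1 + idx x) v ≤ t ∧
        t ≤ Sum.elim (fun v => (M + 1) * r v + M) (fun x => (M + 1) * l x.1 + idx x) v} ⊆
        Sum.inl '' {v | l v ≤ t / (M + 1) ∧ t / (M + 1) ≤ r v} ∪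
        Sum.inr '' {x | (idx x).val = t % (M + 1)} := by
      rintro (v | x) ⟨h1, h2⟩
      · simp only [Sum.elim_inl] at h1 h2
        refine .inl ⟨v, ⟨?_, ?_⟩, rfl⟩
        · rwa [Nat.le_div_iff_mul_le (by omega), mul_comm]
        · rw [← Nat.lt_succ_iff, Nat.div_lt_iff_lt_mul (by omega)]
          nlinarith
      · simp only [Sum.elim_inr] at h1 h2
        refine .inr ⟨x, ?_, rfl⟩
        rw [Set.mem_ofPred_eq, le_antisymm h2 h1, Nat.mul_add_mod,
          Nat.mod_eq_of_lt ((hidx x).trans (Nat.lt_succ_self M))]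
    refine (Set.ncard_le_ncard hsub).trans ((Set.ncard_union_le _ _).trans ?_)
    rw [Set.ncard_image_of_injective _ Sum.inl_injective,
      Set.ncard_image_of_injective _ Sum.inr_injective]
    refine Nat.add_le_add (h.overlap _) ((Set.ncard_le_one_iff).2 fun {x y} hx hy => ?_)
    exact idx.injective (Fin.ext (Eq.trans hx (Eq.symm hy)))

end Intervals

/-! ### The trees `Y_i` -/

section TreeY

instance finite_treeY (i : ℕ) : Finite (treeY i).1 := by
  induction i using treeY.induct with
  | case1 => exact inferInstanceAs (Finite (Fin 1 ⊕ Fin 3))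
  | case2 => exact inferInstanceAs (Finite (Fin 1 ⊕ Fin 3))
  | case3 i ih => exact inferInstanceAs (Finite ((treeY (i + 1)).1 ⊕ leaves (treeY (i + 1)).2 × Bool))

theorem exists_isRootedTree_treeY (n : ℕ) :
    ∃ par r, IsRootedTree (treeY (n + 1)).2 par r := by
  induction n with
  | zero => exact ⟨_, _, isRootedTree_completeBipartiteGraph⟩
  | succ n ih =>
    obtain ⟨par, r, h⟩ := ih
    exact ⟨_, _, h.branchLeaves⟩

theorem exists_isIntervalRep_treeY (n : ℕ) :
    ∃ l r, IsIntervalRep (treeY (n + 1)).2 l r (n + 4) := by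
  induction n with
  | zero =>
    refine ⟨fun _ => 0, fun _ => 0, fun _ => le_rfl, fun _ _ _ => le_rfl, fun t => ?_⟩
    refine (Set.ncard_le_ncard (Set.subset_univ _)).trans ?_
    rw [Set.ncard_univ]
    exact le_of_eq (show Nat.card (Fin 1 ⊕ Fin 3) = 4 by simp)
  | succ n ih =>
    obtain ⟨l, r, h⟩ := ih
    exact h.branchLeaves

theorem two_pow_le_ncard_leaves_treeY (n : ℕ) :
    2 ^ (n + 1) ≤ (leaves (treeY (n + 1)).2).ncard := by
  induction n with
  | zero =>
    have hsub : Sum.inr '' Set.univ ⊆ leaves (completeBipartiteGraph (Fin 1) (Fin 3)) := by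
      rintro _ ⟨j, -, rfl⟩
      have : (completeBipartiteGraph (Fin 1) (Fin 3)).neighborSet (Sum.inr j) = {Sum.inl 0} := by
        ext (x | x)
        · simp [Fin.eq_zero x]
        · simp
      exact (congrArg Set.ncard this).trans (Set.ncard_singleton _)
    have h := Set.ncard_le_ncard hsub
    rw [Set.ncard_image_of_injective _ Sum.inr_injective, Set.ncard_univ, Nat.card_fin] at h
    exact le_trans (by norm_num) h
  | succ n ih =>
    have hsub : Sum.inr '' Set.univ ⊆ leaves (branchLeaves (treeY (n + 1)).2) := by
      rintro _ ⟨x, -, rfl⟩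
      exact inr_mem_leaves_branchLeaves x
    have h := Set.ncard_le_ncard hsub
    rw [Set.ncard_image_of_injective _ Sum.inr_injective, Set.ncard_univ, Nat.card_prod,
      Nat.card_coe_set_eq, Nat.card_eq_fintype_card, Fintype.card_bool] at h
    refine le_trans ?_ h
    rw [pow_succ]
    omega

theorem two_pow_le_card_treeY (n : ℕ) : 2 ^ (n + 1) ≤ Nat.card (treeY (n + 1)).1 := by
  refine (two_pow_le_ncard_leaves_treeY n).trans ?_
  rw [← Set.ncard_univ]
  exact Set.ncard_le_ncard (Set.subset_univ _)

theorem card_treeY_le (n : ℕ) : Nat.card (treeY (n + 1)).1 ≤ 4 * 3 ^ n := by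
  induction n with
  | zero => exact le_of_eq (show Nat.card (Fin 1 ⊕ Fin 3) = 4 by simp)
  | succ n ih =>
    have h1 : Nat.card (treeY (n + 2)).1 =
        Nat.card (treeY (n + 1)).1 + (leaves (treeY (n + 1)).2).ncard * 2 := by
      change Nat.card ((treeY (n + 1)).1 ⊕ leaves (treeY (n + 1)).2 × Bool) = _
      rw [Nat.card_sum, Nat.card_prod, Nat.card_coe_set_eq, Nat.card_eq_fintype_card (α := Bool),
        Fintype.card_bool]
    have h2 : (leaves (treeY (n + 1)).2).ncard ≤ Nat.card (treeY (n + 1)).1 := by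
      rw [← Set.ncard_univ]
      exact Set.ncard_le_ncard (Set.subset_univ _)
    rw [h1, pow_succ]
    omega

theorem card_le_card_edgeSet_barGraph {V : Type*} [Finite V] (G : SimpleGraph V) :
    Nat.card V ≤ Nat.card E(barGraph G) := by
  refine Nat.card_le_card_of_injective
    (fun v => ⟨(s(none, some v), true), mem_edgeSet_barGraph (cone_adj_none v) true⟩) ?_
  intro u v h
  simpa using h

theorem card_edgeSet_barGraph_le {V : Type*} [Finite V] (G : SimpleGraph V) :
    Nat.card E(barGraph G) ≤ 2 * (Nat.card V + 1) ^ 2 := by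
  have h1 := Nat.card_le_card_of_injective (Subtype.val : E(barGraph G) → _) Subtype.val_injective
  have h2 := Nat.card_le_card_of_surjective (Sym2.mk (α := Option V)).uncurry Sym2.mk_surjective
  rw [Nat.card_prod, Nat.card_eq_fintype_card (α := Bool), Fintype.card_bool] at h1
  rw [Nat.card_prod, Finite.card_option] at h2
  nlinarith

theorem log_card_edgeSet_barY_ge (n : ℕ) :
    (n + 1) * Real.log 2 ≤ Real.log (Nat.card E(barY (n + 1))) := by
  have h := (two_pow_le_card_treeY n).trans (card_le_card_edgeSet_barGraph (treeY (n + 1)).2)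
  have h' : (2 : ℝ) ^ (n + 1) ≤ Nat.card E(barY (n + 1)) := by exact_mod_cast h
  have := Real.log_le_log (by positivity) h'
  rw [Real.log_pow] at this
  exact_mod_cast this

theorem log_card_edgeSet_barY_le (n : ℕ) :
    Real.log (Nat.card E(barY (n + 1))) ≤ (n + 1) * Real.log 81 := by
  have h1 := card_treeY_le n
  have h2 : Nat.card E(barY (n + 1)) ≤ 81 ^ (n + 1) := by
    refine (card_edgeSet_barGraph_le (treeY (n + 1)).2).trans ?_
    have h3 : 1 ≤ 3 ^ n := Nat.one_le_pow _ _ (by norm_num)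
    have h4 : 81 ^ n = ((3 ^ n) ^ 2) ^ 2 := by
      rw [← pow_mul, ← pow_mul, mul_comm n, pow_mul]
      norm_num
    have h5 : 1 ≤ (3 ^ n) ^ 2 := Nat.one_le_pow _ _ h3
    calc 2 * (Nat.card (treeY (n + 1)).1 + 1) ^ 2 ≤ 2 * (5 * 3 ^ n) ^ 2 := by
          gcongr
          omega
      _ = 50 * (3 ^ n) ^ 2 := by ring
      _ ≤ 81 ^ (n + 1) := by
          rw [pow_succ 81, h4]
          nlinarith
  have hpos : 0 < Nat.card E(barY (n + 1)) :=
    lt_of_lt_of_le (by positivity)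
      ((two_pow_le_card_treeY n).trans (card_le_card_edgeSet_barGraph (treeY (n + 1)).2))
  have h' : (Nat.card E(barY (n + 1)) : ℝ) ≤ 81 ^ (n + 1) := by exact_mod_cast h2
  have := Real.log_le_log (by exact_mod_cast hpos) h'
  rw [Real.log_pow] at this
  exact_mod_cast this

end TreeY

/-! ### The codes of the graphs `Ȳ_i` -/

section BarY

variable {F : Type*} [Field F]

theorem codeTreewidth_barY {n : ℕ} (D : EdgeOrientation (barY (n + 1))) :
    codeTreewidth (graphCode F D) = 2 := by
  obtain ⟨par, r, h⟩ := exists_isRootedTree_treeY n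
  refine codeTreewidth_eq_two h (le_trans ?_ (two_pow_le_card_treeY n)) D
  exact Nat.le_self_pow n.succ_ne_zero 2

theorem exists_path_barY {n : ℕ} (D : EdgeOrientation (barY (n + 1))) :
    ∃ T : TreeDecomposition E(barY (n + 1)), T.IsPathDecomposition ∧
      constraintComplexity (graphCode F D) T ≤ n + 4 := by
  obtain ⟨l, r, h⟩ := exists_isIntervalRep_treeY n
  obtain ⟨par, root, -⟩ := exists_isRootedTree_treeY n
  have : Nonempty (treeY (n + 1)).1 := ⟨root⟩
  exact h.exists_path D

theorem trellisComplexity_barY_le {n : ℕ} (D : EdgeOrientation (barY (n + 1))) :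
    trellisComplexity (graphCode F D) ≤ n + 4 := by
  obtain ⟨T, hT, hle⟩ := exists_path_barY (F := F) D
  exact (Nat.sInf_le (show _ ∈ {k | ∃ T : TreeDecomposition E(barY (n + 1)),
    T.IsPathDecomposition ∧ constraintComplexity (graphCode F D) T = k} from ⟨T, hT, rfl⟩)).trans hle

theorem le_trellisComplexity_barY {n : ℕ} (D : EdgeOrientation (barY (n + 1))) :
    1 + (n + 1) / 2 + 1 ≤ trellisComplexity (graphCode F D) := by
  -- A path decomposition must exist, since the infimum of the empty set would be 0.
  obtain ⟨T, hT, -⟩ := exists_path_barY (F := F) D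
  refine le_csInf ⟨_, T, hT, rfl⟩ ?_
  rintro _ ⟨T, hT, rfl⟩
  obtain ⟨r, u, S, hS, hr, hru, hd⟩ := exists_three_isBinaryTree_treeY n
  exact le_constraintComplexity_of_isPathDecomposition hT (by omega) fun τ hτ =>
    widthGE_of_three_isBinaryTree hτ hS hr hru hd

theorem le_gap_barY {n : ℕ} (D : EdgeOrientation (barY (n + 1))) :
    (n : ℝ) / 2 ≤ trellisComplexity (graphCode F D) - codeTreewidth (graphCode F D) := by
  have h1 := le_trellisComplexity_barY (F := F) D
  rw [codeTreewidth_barY D]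
  have h2 : n + 4 ≤ 2 * trellisComplexity (graphCode F D) := by omega
  have h3 : (n : ℝ) + 4 ≤ 2 * trellisComplexity (graphCode F D) := by exact_mod_cast h2
  push_cast
  linarith

theorem gap_barY_le {n : ℕ} (D : EdgeOrientation (barY (n + 1))) :
    (trellisComplexity (graphCode F D) : ℝ) - codeTreewidth (graphCode F D) ≤ n + 2 := by
  have h1 : (trellisComplexity (graphCode F D) : ℝ) ≤ n + 4 := by
    exact_mod_cast trellisComplexity_barY_le (F := F) D
  rw [codeTreewidth_barY D]
  push_cast
  linarith

theorem tendsto_gap_barY (D : ∀ i, EdgeOrientation (barY i)) :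
    Tendsto (fun i => (trellisComplexity (graphCode F (D i)) : ℝ) -
      codeTreewidth (graphCode F (D i))) atTop atTop := by
  rw [← tendsto_add_atTop_iff_nat 1]
  exact tendsto_atTop_mono (fun n => le_gap_barY (D (n + 1)))
    (tendsto_natCast_atTop_atTop.atTop_div_const two_pos)

theorem gap_barY_isTheta_log (D : ∀ i, EdgeOrientation (barY i)) :
    (fun i => (trellisComplexity (graphCode F (D i)) : ℝ) - codeTreewidth (graphCode F (D i)))
      =Θ[atTop] (fun i => Real.log (Nat.card E(barY i))) := by
  have hlog2 : 0 < Real.log 2 := Real.log_pos (by norm_num)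
  have hlog81 : 0 < Real.log 81 := Real.log_pos (by norm_num)
  constructor
  · refine IsBigO.of_bound (2 / Real.log 2) (eventually_atTop.2 ⟨1, fun i hi => ?_⟩)
    obtain ⟨n, rfl⟩ := Nat.exists_eq_add_of_le' hi
    have h1 := le_gap_barY (F := F) (D (n + 1))
    have h2 := gap_barY_le (F := F) (D (n + 1))
    have h3 := log_card_edgeSet_barY_ge n
    have hn : (0 : ℝ) ≤ n := n.cast_nonneg
    rw [Real.norm_of_nonneg (by linarith), Real.norm_of_nonneg (le_trans (by positivity) h3)]
    refine h2.trans ?_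
    rw [div_mul_eq_mul_div, le_div_iff₀ hlog2]
    nlinarith
  -- With `i = n + 1`, the gap is at least `n / 2` and the logarithm at most `(n + 1) * log 81`; `n
  -- + 1 ≤ 2 * n` requires `i ≥ 2`.
  · refine IsBigO.of_bound (4 * Real.log 81) (eventually_atTop.2 ⟨2, fun i hi => ?_⟩)
    obtain ⟨n, rfl⟩ := Nat.exists_eq_add_of_le' (le_trans one_le_two hi)
    have h1 := le_gap_barY (F := F) (D (n + 1))
    have h3 := log_card_edgeSet_barY_ge n
    have h4 := log_card_edgeSet_barY_le n
    have hn : (1 : ℝ) ≤ n := by exact_mod_cast (by omega : 1 ≤ n)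
    rw [Real.norm_of_nonneg (le_trans (by positivity) h3), Real.norm_of_nonneg (by linarith)]
    nlinarith

theorem exists_edgeOrientation {α β : Type*} (G : Graph α β) : Nonempty (EdgeOrientation G) := by
  choose t h hth using fun e : E(G) => (G.edge_mem_iff_exists_isLink e.1).1 e.2
  exact ⟨⟨t, h, hth⟩⟩

end BarY

theorem mainTheorem5 (F : Type*) [Field F] [Finite F] :
    -- a family of codes for which the gap tends to infinity
    (∃ (I : ℕ → Type) (_ : ∀ i, Finite (I i)) (C : ∀ i, Submodule F (I i → F)),
      Tendsto (fun i => (trellisComplexity (C i) : ℝ) - codeTreewidth (C i)) atTop atTop) ∧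
    -- there is no upper bound on the gap
    (¬ ∃ B : ℕ, ∀ (I : Type) [Finite I] (C : Submodule F (I → F)),
      trellisComplexity C ≤ codeTreewidth C + B) ∧
    -- the codes of the graphs `Ȳ_i`, for any orientations of their edges, are such a family
    (∀ D : ∀ i, EdgeOrientation (barY i),
      (∀ i, 1 ≤ i → codeTreewidth (graphCode F (D i)) = 2 ∧
        ⌈((i : ℝ) + 3) / 2⌉ ≤ (trellisComplexity (graphCode F (D i)) : ℤ)) ∧
      Tendsto (fun i => (trellisComplexity (graphCode F (D i)) : ℝ) -
        codeTreewidth (graphCode F (D i))) atTop atTop ∧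
      (fun i => (trellisComplexity (graphCode F (D i)) : ℝ) - codeTreewidth (graphCode F (D i)))
        =Θ[atTop] (fun i => Real.log (Nat.card E(barY i)))) := by
  have D₀ : ∀ i, EdgeOrientation (barY i) := fun i => (exists_edgeOrientation (barY i)).some
  refine ⟨⟨_, fun i => inferInstance, fun i => graphCode F (D₀ i), tendsto_gap_barY D₀⟩, ?_,
    fun D => ⟨fun i hi => ?_, tendsto_gap_barY D, gap_barY_isTheta_log D⟩⟩
  · rintro ⟨B, hB⟩
    obtain ⟨i, hi⟩ := ((tendsto_gap_barY (F := F) D₀).eventually_gt_atTop (B : ℝ)).exists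
    have h : (trellisComplexity (graphCode F (D₀ i)) : ℝ) ≤
        codeTreewidth (graphCode F (D₀ i)) + B := by
      exact_mod_cast hB _ (graphCode F (D₀ i))
    linarith
  · obtain ⟨n, rfl⟩ := Nat.exists_eq_add_of_le' hi
    refine ⟨codeTreewidth_barY (D (n + 1)), Int.ceil_le.2 ?_⟩
    have h1 := le_trellisComplexity_barY (F := F) (D (n + 1))
    have h2 : n + 4 ≤ 2 * trellisComplexity (graphCode F (D (n + 1))) := by omega
    have h3 : (n : ℝ) + 4 ≤ 2 * trellisComplexity (graphCode F (D (n + 1))) := by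
      exact_mod_cast h2
    push_cast
    linarith
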